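/- Let $m,n\ge 1$, let $\mathbb F_n^+$ be the free semigroup on generators $g_1,\dots,g_n$ with identity $g_0$, and for $X=(X_1,\dots,X_n)\in B(\mathcal H)^n$ and $\alpha=g_{i_1}\cdots g_{i_k}$ put $X_\alpha:=X_{i_1}\cdots X_{i_k}$, $X_{g_0}:=I$, $|\alpha|:=k$. Let $\mathcal H$ be a complex Hilbert space and let $f=\sum_\alpha a_\alpha X_\alpha$ be a positive regular free holomorphic function on a ball $\{X\in B(\mathcal H)^n:\|\sum_i X_iX_i^*\|<\rho\}$, $\rho>0$; that is, $a_\alpha\ge 0$, $a_{g_0}=0$, $a_{g_i}>0$ for $i=1,\dots,n$, and $\sum_k\sum_{|\alpha|=k}a_\alpha X_\alpha$ converges in norm at each point of the ball. Put $b_{g_0}:=1$ and $$b_\alpha:=\sum_{j=1}^{|\alpha|}\ \sum_{\gamma_1\cdots\gamma_j=\alpha,\ |\gamma_i|\ge 1} a_{\gamma_1}\cdots a_{\gamma_j}\binom{j+m-1}{m-1}\qquad(|\alpha|\ge 1).$$ Let $F^2(H_n)$ be the full Fock space with orthonormal basis $(e_\alpha)_{\alpha\in\mathbb F_n^+}$,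 and let $W_1,\dots,W_n\in B(F^2(H_n))$ be the weighted left creation operators $W_ie_\alpha=\sqrt{b_\alpha/b_{g_i\alpha}}\;e_{g_i\alpha}$. For a Hilbert space $\mathcal K$ and $X\in B(\mathcal K)^n$ let $\Phi_{f,X}(Y):=\sum_{|\alpha|\ge1}a_\alpha X_\alpha YX_\alpha^*$ (WOT convergence), and let $\mathbf D_f^m(\mathcal K)$ be the set of all $X\in B(\mathcal K)^n$ such that $\sum_{|\alpha|\ge 1} a_\alpha X_\alpha X_\alpha^*$ is WOT convergent and $(\mathrm{id}-\Phi_{f,X})^k(I)\ge 0$ for $1\le k\le m$. A tuple $X\in\mathbf D_f^m(\mathcal K)$ is pure if $\Phi_{f,X}^k(I)\to0$ strongly as $k\to\infty$, and has the radial property if there is $\delta\in(0,1)$ with $rX\in\mathbf D_f^m(\mathcal K)$ for all $r\in(\delta,1)$. Let $F_n^\infty(\mathbf D_f^m)$ be the set of all $g\in B(F^2(H_n))$ for which there are $c_\beta\in\mathbb C$ with $\sum_\beta|c_\beta|^2/b_\beta<\infty$ and $gp=\sum_\beta c_\beta W_\beta p$ for every $p$ in the linear span of $\{e_\alpha\}$;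 we write $g=\sum_\beta c_\beta W_\beta$. Let $T=(T_1,\dots,T_n)\in\mathbf D_f^m(\mathcal H)$ be pure. Let $\Delta:=[(\mathrm{id}-\Phi_{f,T})^m(I)]^{1/2}$, let $K:\mathcal H\to F^2(H_n)\otimes\mathcal H$, $Kh:=\sum_\alpha\sqrt{b_\alpha}\,e_\alpha\otimes\Delta T_\alpha^*h$, be the noncommutative Berezin kernel, and let $\widetilde{\mathbf B}_T[g]:=K^*(g\otimes I_{\mathcal H})K$ for $g\in B(F^2(H_n))$. Then $K$ is a well-defined bounded operator, $F_n^\infty(\mathbf D_f^m)$ is a unital subalgebra of $B(F^2(H_n))$, and the map $\Psi_T:F_n^\infty(\mathbf D_f^m)\to B(\mathcal H)$, $\Psi_T(g):=\widetilde{\mathbf B}_T[g]$, has the following properties. (i) $\Psi_T$ is WOT-continuous and SOT-continuous on bounded sets: its restriction to every norm-bounded subset of $F_n^\infty(\mathbf D_f^m)$ is continuous from WOT to WOT and from SOT to SOT. (ii) $\Psi_T$ is a unital completely contractive homomorphism, and $W_\alpha\in F_n^\infty(\mathbf D_f^m)$, $\Psi_T(W_\alpha)=T_\alpha$ for all $\alpha\in\mathbb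 F_n^+$. If, in addition, $(W_1,\dots,W_n)$ has the radial property in $\mathbf D_f^m(F^2(H_n))$, then for every $g=\sum_\beta c_\beta W_\beta$ in $F_n^\infty(\mathbf D_f^m)$ the series $g(rT):=\sum_{k=0}^\infty\sum_{|\alpha|=k}c_\alpha r^{|\alpha|}T_\alpha$ converges in the operator norm for every $r\in(0,1)$, and $\Psi_T(g)=\text{SOT-}\lim_{r\to1^-}g(rT)$. -/

import Mathlib

open Filter Topology ContinuousLinearMap
open scoped TensorProduct

noncomputable section

/-- The product `X_α = X_{i₁} ⋯ X_{i_k}` along a word `α = g_{i₁} ⋯ g_{i_k}` of the free semigroup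
on `n` generators; words are lists over `Fin n`, and `X_∅ = I`. -/
def wordOp {n : ℕ} {H : Type*} [NormedAddCommGroup H] [InnerProductSpace ℂ H]
    (X : Fin n → H →L[ℂ] H) (α : List (Fin n)) : H →L[ℂ] H :=
  (α.map X).prod

/-- The partial sum `∑_{k < N} ∑_{|α| = k} c_α X_α` of a noncommutative power series. -/
def ncPartialSum {n : ℕ} {H : Type*} [NormedAddCommGroup H] [InnerProductSpace ℂ H]
    (c : List (Fin n) → ℂ) (X : Fin n → H →L[ℂ] H) (N : ℕ) : H →L[ℂ] H :=
  ∑ k ∈ Finset.range N, ∑ w : Fin k → Fin n, c (List.ofFn w) • wordOp X (List.ofFn w)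

/-- The coefficients of a positive regular noncommutative power series `f = ∑ a_α X_α`:
`a_α ≥ 0`, `a_∅ = 0`, and `a_{g_i} > 0` for every generator. -/
structure PosRegularSeries (n : ℕ) where
  a : List (Fin n) → ℝ
  nonneg : ∀ α, 0 ≤ a α
  nil : a [] = 0
  pos : ∀ i, 0 < a [i]

/-- `f` is free holomorphic on the ball `{X ∈ B(H)^n : ‖X₁X₁* + ⋯ + X_nX_n*‖ < ρ}`: the series
`∑_k ∑_{|α|=k} a_α X_α` converges in the operator norm at every point of the ball. -/
def PosRegularSeries.FreeHolomorphicOn {n : ℕ} (f : PosRegularSeries n) (H : Type*)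
    [NormedAddCommGroup H] [InnerProductSpace ℂ H] [CompleteSpace H] (ρ : ℝ) : Prop :=
  ∀ X : Fin n → H →L[ℂ] H, ‖∑ i, X i ∘L adjoint (X i)‖ < ρ →
    ∃ L, Tendsto (ncPartialSum (fun α => (f.a α : ℂ)) X) atTop (𝓝 L)

/-- The coefficients of `(1 - f)^{-m}`:
`b_α = ∑_j ∑_{γ₁⋯γ_j = α, |γ_i| ≥ 1} a_{γ₁} ⋯ a_{γ_j} binom(j+m-1, m-1)`.
The factorizations of `α` into nonempty words correspond to the compositions of `|α|`; for the
empty word the sum is the single empty product, so `b_∅ = 1`. -/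
def bCoeff {n : ℕ} (f : PosRegularSeries n) (m : ℕ) (α : List (Fin n)) : ℝ :=
  ∑ c : Composition α.length,
    ((α.splitWrtComposition c).map f.a).prod * ((c.length + m - 1).choose (m - 1) : ℝ)

/-- The full Fock space `F²(H_n)`, with the orthonormal basis `(e_α)` indexed by words. -/
abbrev Fock (n : ℕ) : Type := lp (fun _ : List (Fin n) => ℂ) 2

/-- The basis vector `e_α`. -/
def fockBasis {n : ℕ} (α : List (Fin n)) : Fock n := lp.single 2 α (1 : ℂ)

theorem bCoeff_nil {n : ℕ} (f : PosRegularSeries n) (m : ℕ) : bCoeff f m [] = 1 := by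
  have h : ∀ c : Composition ([] : List (Fin n)).length, c.blocks = [] := fun c =>
    c.blocks_eq_nil.2 rfl
  have hu : (Finset.univ : Finset (Composition ([] : List (Fin n)).length)) =
      {Composition.ones 0} :=
    Finset.eq_singleton_iff_unique_mem.2 ⟨Finset.mem_univ _, fun c _ =>
      Composition.ext ((h c).trans (h (Composition.ones 0)).symm)⟩
  rw [bCoeff, hu, Finset.sum_singleton]
  simp [List.splitWrtComposition, List.splitWrtCompositionAux]

theorem le_bCoeff_cons {n : ℕ} (f : PosRegularSeries n) (m : ℕ) (i : Fin n) (α : List (Fin n)) :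
    f.a [i] * bCoeff f m α ≤ bCoeff f m (i :: α) := by
  let φ : Composition α.length → Composition (i :: α).length := fun c =>
    ⟨1 :: c.blocks, by
      intro j hj
      rcases List.mem_cons.1 hj with rfl | hj
      · exact one_pos
      · exact c.blocks_pos hj, by simp [c.blocks_sum, add_comm]⟩
  have hφ : Function.Injective φ := fun c d h =>
    Composition.ext (List.cons_injective (congrArg Composition.blocks h))
  have hnn : ∀ L : List (List (Fin n)), 0 ≤ (L.map f.a).prod := fun L =>
    List.prod_nonneg (by
      intro x hx
      obtain ⟨γ, -, rfl⟩ := List.mem_map.1 hx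
      exact f.nonneg γ)
  have hterm : ∀ c : Composition α.length,
      f.a [i] * (((α.splitWrtComposition c).map f.a).prod *
        ((c.length + m - 1).choose (m - 1) : ℝ)) ≤
      (((i :: α).splitWrtComposition (φ c)).map f.a).prod *
        (((φ c).length + m - 1).choose (m - 1) : ℝ) := by
    intro c
    have h1 : (i :: α).splitWrtComposition (φ c) = [i] :: α.splitWrtComposition c := by
      simp [List.splitWrtComposition, φ, List.splitWrtCompositionAux]
    have h2 : c.length ≤ (φ c).length := by simp [Composition.length, φ]
    rw [h1, List.map_cons, List.prod_cons, mul_assoc]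
    refine mul_le_mul_of_nonneg_left (mul_le_mul_of_nonneg_left ?_ (hnn _)) (f.nonneg _)
    exact_mod_cast Nat.choose_le_choose _ (by omega)
  calc f.a [i] * bCoeff f m α
      ≤ ∑ c, (((i :: α).splitWrtComposition (φ c)).map f.a).prod *
        (((φ c).length + m - 1).choose (m - 1) : ℝ) := by
        rw [bCoeff, Finset.mul_sum]
        exact Finset.sum_le_sum fun c _ => hterm c
    _ ≤ bCoeff f m (i :: α) := by
        rw [bCoeff, ← Finset.sum_image (f := fun d : Composition (i :: α).length =>
          (((i :: α).splitWrtComposition d).map f.a).prod *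
            ((d.length + m - 1).choose (m - 1) : ℝ)) (fun c _ d _ h => hφ h)]
        exact Finset.sum_le_sum_of_subset_of_nonneg (Finset.subset_univ _) fun d _ _ =>
          mul_nonneg (hnn _) (Nat.cast_nonneg _)

theorem bCoeff_pos {n : ℕ} (f : PosRegularSeries n) (m : ℕ) (α : List (Fin n)) :
    0 < bCoeff f m α := by
  induction α with
  | nil => simp [bCoeff_nil]
  | cons i α ih => exact (mul_pos (f.pos i) ih).trans_le (le_bCoeff_cons f m i α)

/-- The weight `√b_α / √b_{g_i α}` of the weighted left creation operator `W_i`. -/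
def shiftWeight {n : ℕ} (f : PosRegularSeries n) (m : ℕ) (i : Fin n) (α : List (Fin n)) : ℝ :=
  √(bCoeff f m α) / √(bCoeff f m (i :: α))

theorem shiftWeight_le {n : ℕ} (f : PosRegularSeries n) (m : ℕ) (i : Fin n) (α : List (Fin n)) :
    shiftWeight f m i α ≤ √(f.a [i])⁻¹ := by
  rw [shiftWeight, ← Real.sqrt_div (bCoeff_pos f m α).le]
  refine Real.sqrt_le_sqrt ?_
  rw [div_le_iff₀ (bCoeff_pos f m _), inv_mul_eq_div, le_div_iff₀ (f.pos i), mul_comm]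
  exact le_bCoeff_cons f m i α

/-- The sequence of coordinates of `W_i x`: the coordinate at `g_i α` is the weight times `x_α`,
and the coordinates at words not starting with `g_i` vanish. -/
def shiftFun {n : ℕ} (f : PosRegularSeries n) (m : ℕ) (i : Fin n) (x : List (Fin n) → ℂ) :
    List (Fin n) → ℂ
  | [] => 0
  | j :: α => if j = i then (shiftWeight f m i α : ℂ) * x α else 0

theorem hasSum_shiftFun {n : ℕ} (f : PosRegularSeries n) (m : ℕ) (i : Fin n) (x : Fock n) :
    ∃ s ≤ (√(f.a [i])⁻¹ * ‖x‖) ^ 2, HasSum (fun β => ‖shiftFun f m i x β‖ ^ 2) s := by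
  have hx : HasSum (fun α => ‖x α‖ ^ 2) (‖x‖ ^ 2) := by
    simpa using lp.hasSum_norm (p := 2) (by simp) x
  have hle : ∀ α, ‖(shiftWeight f m i α : ℂ) * x α‖ ^ 2 ≤ (√(f.a [i])⁻¹) ^ 2 * ‖x α‖ ^ 2 := by
    intro α
    have h0 : 0 ≤ shiftWeight f m i α := div_nonneg (Real.sqrt_nonneg _) (Real.sqrt_nonneg _)
    rw [norm_mul, mul_pow, Complex.norm_real, Real.norm_of_nonneg h0]
    gcongr
    exact shiftWeight_le f m i α
  have hsum : Summable fun α => ‖(shiftWeight f m i α : ℂ) * x α‖ ^ 2 :=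
    Summable.of_nonneg_of_le (fun _ => sq_nonneg _) hle (hx.summable.mul_left _)
  refine ⟨_, ?_, (Function.Injective.hasSum_iff (g := List.cons i) (a := ∑' α, ‖(shiftWeight f m i α : ℂ) * x α‖ ^ 2)
    List.cons_injective ?_).1 ?_⟩
  · rw [mul_pow, ← hx.tsum_eq, ← tsum_mul_left]
    exact hsum.tsum_le_tsum hle (hx.summable.mul_left _)
  · intro β hβ
    cases β with
    | nil => simp [shiftFun]
    | cons j α =>
      have : j ≠ i := by
        rintro rfl
        exact hβ ⟨α, rfl⟩
      simp [shiftFun, this]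
  · simpa [Function.comp_def, shiftFun] using hsum.hasSum

/-- The weighted left creation operator: `W_i e_α = (√b_α / √b_{g_i α}) e_{g_i α}`
(see `weightedShift_basis`). -/
def weightedShift {n : ℕ} (f : PosRegularSeries n) (m : ℕ) (i : Fin n) : Fock n →L[ℂ] Fock n :=
  LinearMap.mkContinuous
    { toFun := fun x => ⟨shiftFun f m i x, memℓp_gen (by
        obtain ⟨s, -, hs⟩ := hasSum_shiftFun f m i x
        simpa using hs.summable)⟩
      map_add' := fun x y => by
        ext β
        change shiftFun f m i (x + y) β = shiftFun f m i x β + shiftFun f m i y β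
        rcases β with _ | ⟨j, α⟩
        · simp [shiftFun]
        · simp only [shiftFun, Pi.add_apply]
          split_ifs <;> ring
      map_smul' := fun c x => by
        ext β
        change shiftFun f m i (c • x) β = c * shiftFun f m i x β
        rcases β with _ | ⟨j, α⟩
        · simp [shiftFun]
        · simp only [shiftFun, Pi.smul_apply, smul_eq_mul]
          split_ifs <;> ring }
    (√(f.a [i])⁻¹) fun x => by
      obtain ⟨s, hle, hs⟩ := hasSum_shiftFun f m i x
      refine lp.norm_le_of_tsum_le (p := 2) (by simp) (by positivity) ?_
      simpa using hs.tsum_eq.le.trans hle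

theorem weightedShift_basis {n : ℕ} (f : PosRegularSeries n) (m : ℕ) (i : Fin n)
    (α : List (Fin n)) :
    weightedShift f m i (fockBasis α) = (shiftWeight f m i α : ℂ) • fockBasis (i :: α) := by
  ext β
  change shiftFun f m i (fockBasis α) β = (shiftWeight f m i α : ℂ) * fockBasis (i :: α) β
  rcases β with _ | ⟨j, γ⟩
  · simp [shiftFun, fockBasis]
  · by_cases hj : j = i
    · subst hj
      by_cases hγ : γ = α
      · subst hγ; simp [shiftFun, fockBasis]
      · simp [shiftFun, fockBasis, hγ]
    · simp [shiftFun, fockBasis, hj]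

section Hilbert

variable {n : ℕ} {H : Type*} [NormedAddCommGroup H] [InnerProductSpace ℂ H] [CompleteSpace H]

/-- The terms `a_α X_α Y X_α*` of `Φ_{f,X}(Y)`, as elements of `B(H)` with the weak operator
topology. The term of the empty word vanishes. -/
def phiTerm (f : PosRegularSeries n) (X : Fin n → H →L[ℂ] H) (Y : H →L[ℂ] H)
    (α : List (Fin n)) : H →WOT[ℂ] H :=
  .ofCLM ((f.a α : ℂ) • (wordOp X α ∘L Y ∘L adjoint (wordOp X α)))

/-- `Φ_{f,X}(Y) = ∑_{|α| ≥ 1} a_α X_α Y X_α*`, the sum being taken in the weak operator topology. -/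
def phi (f : PosRegularSeries n) (X : Fin n → H →L[ℂ] H) (Y : H →L[ℂ] H) : H →L[ℂ] H :=
  (∑' α, phiTerm f X Y α).toCLM

/-- `(id - Φ_{f,X})^k (I)`. -/
def defectPow (f : PosRegularSeries n) (k : ℕ) (X : Fin n → H →L[ℂ] H) : H →L[ℂ] H :=
  (fun Y => Y - phi f X Y)^[k] 1

/-- The noncommutative domain `D_f^m(H)`: the series `∑ a_α X_α X_α*` is WOT-convergent and
`(id - Φ_{f,X})^k (I) ≥ 0` for `1 ≤ k ≤ m`. -/
def ncDomain (f : PosRegularSeries n) (m : ℕ) (H : Type*) [NormedAddCommGroup H]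
    [InnerProductSpace ℂ H] [CompleteSpace H] : Set (Fin n → H →L[ℂ] H) :=
  {X | Summable (phiTerm f X 1) ∧ ∀ k, 1 ≤ k → k ≤ m → (defectPow f k X).IsPositive}

/-- `T` is pure: `Φ_{f,T}^k(I) → 0` strongly. -/
def IsPure (f : PosRegularSeries n) (T : Fin n → H →L[ℂ] H) : Prop :=
  ∀ x, Tendsto (fun k : ℕ => ((phi f T)^[k] 1) x) atTop (𝓝 0)

/-- The radial property of a tuple `X` in `D_f^m(H)`: `rX ∈ D_f^m(H)` for all `r` in some
interval `(δ, 1)`, `0 < δ < 1`. -/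
def HasRadialProperty (f : PosRegularSeries n) (m : ℕ) (X : Fin n → H →L[ℂ] H) : Prop :=
  X ∈ ncDomain f m H ∧
    ∃ δ ∈ Set.Ioo (0 : ℝ) 1, ∀ r ∈ Set.Ioo δ 1, (fun i => (r : ℂ) • X i) ∈ ncDomain f m H

/-- The Hilbert space tensor product `F²(H_n) ⊗ H`. -/
abbrev FockTensor (n : ℕ) (H : Type*) [NormedAddCommGroup H] [InnerProductSpace ℂ H] : Type _ :=
  UniformSpace.Completion (Fock n ⊗[ℂ] H)

/-- The operator `g ⊗ I_H` on `F²(H_n) ⊗ H`. -/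
def ampliation (H : Type*) [NormedAddCommGroup H] [InnerProductSpace ℂ H]
    (g : Fock n →L[ℂ] Fock n) : FockTensor n H →L[ℂ] FockTensor n H :=
  (g.rTensor H).completion

/-- The defect operator `Δ_{f,m,T} = [(id - Φ_{f,T})^m(I)]^{1/2}`. -/
def defectOp (f : PosRegularSeries n) (m : ℕ) (T : Fin n → H →L[ℂ] H) : H →L[ℂ] H :=
  CFC.sqrt (defectPow f m T)

/-- The term `√b_α e_α ⊗ Δ_{f,m,T} T_α* h` of the series defining the Berezin kernel. -/
def kernelTerm (f : PosRegularSeries n) (m : ℕ) (T : Fin n → H →L[ℂ] H) (h : H)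
    (α : List (Fin n)) : FockTensor n H :=
  ((√(bCoeff f m α) : ℂ) • fockBasis α) ⊗ₜ[ℂ] defectOp f m T (adjoint (wordOp T α) h)

open Classical in
/-- The noncommutative Berezin kernel `K h = ∑_α √b_α e_α ⊗ Δ_{f,m,T} T_α* h`, the unique bounded
operator `H → F²(H_n) ⊗ H` given by this series (and `0` if the series does not define one). -/
def berezinKernel (f : PosRegularSeries n) (m : ℕ) (T : Fin n → H →L[ℂ] H) :
    H →L[ℂ] FockTensor n H :=
  if hK : ∃ K : H →L[ℂ] FockTensor n H, ∀ h, HasSum (kernelTerm f m T h) (K h)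
  then hK.choose else 0

/-- The extended noncommutative Berezin transform `g ↦ K* (g ⊗ I_H) K`. -/
def berezinTransform (f : PosRegularSeries n) (m : ℕ) (T : Fin n → H →L[ℂ] H)
    (g : Fock n →L[ℂ] Fock n) : H →L[ℂ] H :=
  adjoint (berezinKernel f m T) ∘L ampliation H g ∘L berezinKernel f m T

/-- The bounded operator `g` on the Fock space has the Fourier representation `∑_β c_β W_β`:
`∑ |c_β|² / b_β < ∞` and `g p = ∑_β c_β W_β p` for every polynomial `p`, i.e. for every finite
linear combination of the `e_α`. -/
def HasFourierRep (f : PosRegularSeries n) (m : ℕ) (g : Fock n →L[ℂ] Fock n)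
    (c : List (Fin n) → ℂ) : Prop :=
  Summable (fun β => ‖c β‖ ^ 2 / bCoeff f m β) ∧
    ∀ p ∈ Submodule.span ℂ (Set.range (fockBasis (n := n))),
      HasSum (fun β => c β • wordOp (weightedShift f m) β p) (g p)

/-- The Hardy algebra `F_n^∞(D_f^m)`, as a set of bounded operators on the Fock space. -/
def hardySet (f : PosRegularSeries n) (m : ℕ) : Set (Fock n →L[ℂ] Fock n) :=
  {g | ∃ c, HasFourierRep f m g c}

end Hilbert

/-- The weak operator topology on `B(H)`. -/
abbrev wot (H : Type*) [NormedAddCommGroup H] [InnerProductSpace ℂ H] :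
    TopologicalSpace (H →L[ℂ] H) :=
  .induced (fun A => (ContinuousLinearMapWOT.ofCLM A : H →WOT[ℂ] H)) inferInstance

/-- The strong operator topology on `B(H)`. -/
abbrev sot (H : Type*) [NormedAddCommGroup H] [InnerProductSpace ℂ H] :
    TopologicalSpace (H →L[ℂ] H) :=
  .induced (toPointwiseConvergenceCLM ℂ (RingHom.id ℂ) H H) inferInstance

/-- A `k × k` matrix of operators on `H`, as an operator on the Hilbert space direct sum `H^(k)`. -/
def matrixOp {k : ℕ} {H : Type*} [NormedAddCommGroup H] [InnerProductSpace ℂ H]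
    (A : Matrix (Fin k) (Fin k) (H →L[ℂ] H)) :
    PiLp 2 (fun _ : Fin k => H) →L[ℂ] PiLp 2 (fun _ : Fin k => H) :=
  (PiLp.continuousLinearEquiv 2 ℂ (fun _ : Fin k => H)).symm.toContinuousLinearMap ∘L
    ContinuousLinearMap.pi fun i => ∑ j, A i j ∘L PiLp.proj 2 (fun _ : Fin k => H) j

/-- A linear map `u` from an algebra of operators on `E` to `B(H)` is completely contractive:
`‖[u(x_ij)]‖ ≤ ‖[x_ij]‖` for all matrices over the algebra, of every size. -/
def IsCompletelyContractive {E H : Type*} [NormedAddCommGroup E] [InnerProductSpace ℂ E]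
    [NormedAddCommGroup H] [InnerProductSpace ℂ H] {A : Subalgebra ℂ (E →L[ℂ] E)}
    (u : A →ₗ[ℂ] (H →L[ℂ] H)) : Prop :=
  ∀ (k : ℕ) (x : Matrix (Fin k) (Fin k) A),
    ‖matrixOp (x.map u)‖ ≤ ‖matrixOp (x.map (fun y => (y : E →L[ℂ] E)))‖

end

/-!
Purity makes the telescoping sums `∑ b_α T_α Δ² T_α*` converge to `I`, so the Berezin kernel `K` is
an isometry, and `K* (W_α ⊗ I) = T_α K*`. For `g = ∑ c_β W_β` in the Hardy algebra, Schur
multiplication by the Gram matrix `r ^ |i - j|` in the lengths of the words produces the dilations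
`g_r = ∑ r ^ |β| c_β W_β` with `‖g_r‖ ≤ ‖g‖`; the homogeneous parts of `g` are also bounded by
`‖g‖`, so `g_r` is a norm limit of polynomials in `rW`. With `R_r e_α = r ^ |α| e_α` one has
`R_r g = g_r R_r`, whence `g_r → g` strongly as `r → 1`. The intertwining relation
`K* (g ⊗ I) = Ψ(g) K*` thus passes from polynomials to the whole Hardy algebra and makes
`Ψ` multiplicative. Being a compression of `g ↦ g ⊗ I` along an isometry, `Ψ` is completely
contractive and continuous on bounded sets.
-/

noncomputable section

section HilbertTensor

variable {E E' E'' H G : Type*} [NormedAddCommGroup E] [InnerProductSpace ℂ E]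
  [NormedAddCommGroup E'] [InnerProductSpace ℂ E'] [NormedAddCommGroup E'']
  [InnerProductSpace ℂ E''] [NormedAddCommGroup H] [InnerProductSpace ℂ H]
  [NormedAddCommGroup G] [NormedSpace ℂ G]

/-- The Hilbert space tensor product, i.e. the completion of the algebraic one;
`HilbertTensor (Fock n) H` is `FockTensor n H`. -/
abbrev HilbertTensor (E H : Type*) [NormedAddCommGroup E] [InnerProductSpace ℂ E]
    [NormedAddCommGroup H] [InnerProductSpace ℂ H] : Type _ :=
  UniformSpace.Completion (E ⊗[ℂ] H)

/-- The elementary tensor `x ⊗ h` of the Hilbert space tensor product, as a bounded bilinear map. -/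
def hilbertTmul : E →L[ℂ] H →L[ℂ] HilbertTensor E H :=
  compL ℂ H (E ⊗[ℂ] H) (HilbertTensor E H) UniformSpace.Completion.toComplL ∘L
    TensorProduct.mkL ℂ E H

theorem hilbertTmul_apply (x : E) (h : H) :
    hilbertTmul x h = ((x ⊗ₜ[ℂ] h : E ⊗[ℂ] H) : HilbertTensor E H) :=
  rfl

@[simp]
theorem inner_hilbertTmul (x y : E) (h k : H) :
    inner ℂ (hilbertTmul x h) (hilbertTmul y k) = inner ℂ x y * inner ℂ h k := by
  simp [hilbertTmul_apply]

@[simp]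
theorem norm_hilbertTmul (x : E) (h : H) : ‖hilbertTmul x h‖ = ‖x‖ * ‖h‖ := by
  simp [hilbertTmul_apply]

theorem dense_span_hilbertTmul {s : Set E} (hs : Dense (Submodule.span ℂ s : Set E)) :
    Dense ((Submodule.span ℂ (Set.image2 (fun x h => hilbertTmul x h) s Set.univ) :
      Submodule ℂ (HilbertTensor E H)) : Set (HilbertTensor E H)) := by
  set S : Submodule ℂ (HilbertTensor E H) :=
    Submodule.span ℂ (Set.image2 (fun x h => hilbertTmul x h) s Set.univ)
  have tmul_mem (x : E) (h : H) : hilbertTmul x h ∈ S.topologicalClosure := by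
    have hle : Submodule.span ℂ s ≤
        S.topologicalClosure.comap (hilbertTmul.flip h).toLinearMap :=
      Submodule.span_le.2 fun y hy =>
        S.le_topologicalClosure (Submodule.subset_span ⟨y, hy, h, ⟨⟩, rfl⟩)
    exact closure_minimal hle
      (S.isClosed_topologicalClosure.preimage (hilbertTmul.flip h).continuous) (hs x)
  have coe_mem (t : E ⊗[ℂ] H) : (t : HilbertTensor E H) ∈ S.topologicalClosure := by
    induction t using TensorProduct.induction_on with
    | zero => exact UniformSpace.Completion.coe_zero (α := E ⊗[ℂ] H) ▸ zero_mem _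
    | tmul x h => exact tmul_mem x h
    | add t u ht hu => exact UniformSpace.Completion.coe_add t u ▸ add_mem ht hu
  rw [Submodule.dense_iff_topologicalClosure_eq_top, Submodule.eq_top_iff']
  exact fun t => UniformSpace.Completion.induction_on t S.isClosed_topologicalClosure coe_mem

theorem hilbertTensor_clm_ext {A B : HilbertTensor E H →L[ℂ] G}
    (h : ∀ x k, A (hilbertTmul x k) = B (hilbertTmul x k)) : A = B := by
  refine ContinuousLinearMap.ext_on (dense_span_hilbertTmul (s := Set.univ) (by simp)) ?_
  rintro _ ⟨x, -, k, -, rfl⟩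
  exact h x k

theorem norm_completion_le (A : E →L[ℂ] E') :
    ‖(A.completion : UniformSpace.Completion E →L[ℂ] UniformSpace.Completion E')‖ ≤ ‖A‖ := by
  refine opNorm_le_bound _ (norm_nonneg _) fun x => ?_
  induction x using UniformSpace.Completion.induction_on with
  | hp => exact isClosed_le (by fun_prop) (by fun_prop)
  | ih x => simpa using A.le_opNorm x

/-- `A ↦ A ⊗ I_H` as a bounded linear map; for `E = E' = Fock n` it is `ampliation H`. -/
def ampliationL (H : Type*) [NormedAddCommGroup H] [InnerProductSpace ℂ H] :
    (E →L[ℂ] E') →L[ℂ] HilbertTensor E H →L[ℂ] HilbertTensor E' H :=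
  LinearMap.mkContinuous
    { toFun := fun A => (A.rTensor H).completion
      map_add' := fun A B => hilbertTensor_clm_ext fun x h => by
        simp [hilbertTmul_apply, UniformSpace.Completion.coe_add]
      map_smul' := fun c A => hilbertTensor_clm_ext fun x h => by
        simp [hilbertTmul_apply, UniformSpace.Completion.coe_smul] }
    1 fun A => by
      rw [one_mul]
      exact (norm_completion_le (A.rTensor H)).trans (ContinuousLinearMap.norm_rTensor_le _ _)

@[simp]
theorem ampliationL_hilbertTmul (A : E →L[ℂ] E') (x : E) (h : H) :
    ampliationL H A (hilbertTmul x h) = hilbertTmul (A x) h := by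
  simp [ampliationL, hilbertTmul_apply, completion_apply_coe]

theorem norm_ampliationL_le (A : E →L[ℂ] E') : ‖ampliationL H A‖ ≤ ‖A‖ :=
  (norm_completion_le (A.rTensor H)).trans (ContinuousLinearMap.norm_rTensor_le _ _)

theorem ampliationL_comp (A : E' →L[ℂ] E'') (B : E →L[ℂ] E') :
    ampliationL H (A ∘L B) = ampliationL H A ∘L ampliationL H B :=
  hilbertTensor_clm_ext fun x k => by simp

theorem ampliationL_one : ampliationL H (1 : E →L[ℂ] E) = 1 :=
  hilbertTensor_clm_ext fun x k => by simp

theorem adjoint_ampliationL [CompleteSpace E] [CompleteSpace E'] (A : E →L[ℂ] E') :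
    adjoint (ampliationL H A) = ampliationL H (adjoint A) := by
  refine hilbertTensor_clm_ext fun x k => ext_inner_right ℂ fun η => ?_
  have h : innerSL ℂ (hilbertTmul x k) ∘L ampliationL H A =
      innerSL ℂ (ampliationL H (adjoint A) (hilbertTmul x k)) :=
    hilbertTensor_clm_ext fun y l => by simp [adjoint_inner_left]
  rw [adjoint_inner_left]
  exact congr($h η)

end HilbertTensor

section BoundedConvergence

variable {ι X Y : Type*} [NormedAddCommGroup X] [NormedSpace ℂ X] {l : Filter ι} {C : ℝ}

theorem tendsto_apply_of_dense_span [NormedAddCommGroup Y] [NormedSpace ℂ Y] {B : ι → X →L[ℂ] Y}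
    {B₀ : X →L[ℂ] Y} (hB : ∀ᶠ i in l, ‖B i‖ ≤ C) {s : Set X}
    (hs : Dense (Submodule.span ℂ s : Set X))
    (h : ∀ x ∈ s, Tendsto (fun i => B i x) l (𝓝 (B₀ x))) (x : X) :
    Tendsto (fun i => B i x) l (𝓝 (B₀ x)) := by
  have tendsto_span : ∀ y ∈ Submodule.span ℂ s, Tendsto (fun i => B i y) l (𝓝 (B₀ y)) := by
    intro y hy
    induction hy using Submodule.span_induction with
    | mem y hy => exact h y hy
    | zero => simpa using tendsto_const_nhds
    | add y z _ _ hy hz => simpa using hy.add hz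
    | smul c y _ hy => simpa using hy.const_smul c
  rw [Metric.tendsto_nhds]
  intro ε hε
  obtain ⟨D, hD, hD₀⟩ : ∃ D, D = |C| + ‖B₀‖ + 1 ∧ 0 < D := ⟨_, rfl, by positivity⟩
  obtain ⟨y, hxy, hy⟩ := Metric.dense_iff.1 hs x (ε / (2 * D)) (by positivity)
  have hDy : D * dist x y ≤ ε / 2 := by
    rw [Metric.mem_ball'] at hxy
    calc D * dist x y ≤ D * (ε / (2 * D)) := by gcongr
      _ = ε / 2 := by field_simp
  filter_upwards [hB, Metric.tendsto_nhds.1 (tendsto_span y hy) (ε / 2) (half_pos hε)]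
    with i hi hiy
  have hBi : dist (B i x) (B i y) ≤ |C| * dist x y :=
    (B i).dist_le_opNorm x y |>.trans (by gcongr; exact hi.trans (le_abs_self C))
  have hB₀ : dist (B₀ x) (B₀ y) ≤ ‖B₀‖ * dist x y := B₀.dist_le_opNorm x y
  have htri := dist_triangle4_right (B i x) (B₀ x) (B i y) (B₀ y)
  nlinarith [dist_nonneg (x := x) (y := y)]

theorem tendsto_inner_apply_of_dense_span [NormedAddCommGroup Y] [InnerProductSpace ℂ Y]
    {B : ι → X →L[ℂ] Y} {B₀ : X →L[ℂ] Y} (hB : ∀ᶠ i in l, ‖B i‖ ≤ C) {s : Set X} {t : Set Y}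
    (hs : Dense (Submodule.span ℂ s : Set X)) (ht : Dense (Submodule.span ℂ t : Set Y))
    (h : ∀ x ∈ s, ∀ y ∈ t, Tendsto (fun i => inner ℂ y (B i x)) l (𝓝 (inner ℂ y (B₀ x))))
    (x : X) (y : Y) : Tendsto (fun i => inner ℂ y (B i x)) l (𝓝 (inner ℂ y (B₀ x))) := by
  have left (y : Y) (hy : y ∈ t) (x : X) :
      Tendsto (fun i => inner ℂ y (B i x)) l (𝓝 (inner ℂ y (B₀ x))) := by
    refine tendsto_apply_of_dense_span (B := fun i => innerSL ℂ y ∘L B i)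
      (B₀ := innerSL ℂ y ∘L B₀) (C := ‖y‖ * C) ?_ hs (fun x hx => h x hx y hy) x
    filter_upwards [hB] with i hi
    refine (opNorm_comp_le _ _).trans ?_
    rw [innerSL_apply_norm]
    gcongr
  have right : Tendsto (fun i => inner ℂ (B i x) y) l (𝓝 (inner ℂ (B₀ x) y)) := by
    refine tendsto_apply_of_dense_span (B := fun i => innerSL ℂ (B i x))
      (B₀ := innerSL ℂ (B₀ x)) (C := C * ‖x‖) ?_ ht (fun y hy => ?_) y
    · filter_upwards [hB] with i hi
      simpa using (B i).le_of_opNorm_le hi x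
    · simpa only [RCLike.star_def, inner_conj_symm] using! (left y hy x).star
  simpa only [RCLike.star_def, inner_conj_symm] using right.star

end BoundedConvergence

section Columns

variable {ι E E' H : Type*} [NormedAddCommGroup E] [InnerProductSpace ℂ E]
  [NormedAddCommGroup E'] [InnerProductSpace ℂ E'] [NormedAddCommGroup H] [InnerProductSpace ℂ H]
  {v : ι → E} {A : ι → E' →L[ℂ] H} {V : E' →L[ℂ] HilbertTensor E H}

/-- The isometry `h ↦ v ⊗ h` given by a unit vector `v`. -/
def hilbertTmulLI (H : Type*) [NormedAddCommGroup H] [InnerProductSpace ℂ H] {v : E}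
    (hv : ‖v‖ = 1) : H →ₗᵢ[ℂ] HilbertTensor E H where
  toLinearMap := (hilbertTmul v).toLinearMap
  norm_map' h := (norm_hilbertTmul v h).trans (by rw [hv, one_mul])

theorem orthogonalFamily_hilbertTmulLI (hv : Orthonormal ℂ v) :
    OrthogonalFamily ℂ (fun _ => H) fun i => hilbertTmulLI H (hv.norm_eq_one i) :=
  fun i j hij h k => (inner_hilbertTmul (v i) (v j) h k).trans (by
    rw [hv.inner_eq_zero hij, zero_mul])

/-- `V x = ∑ i, v i ⊗ A i x` for all `x`, i.e. `V` is the column with entries `A i` relative to the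
family `v`. -/
def IsColumn (v : ι → E) (A : ι → E' →L[ℂ] H) (V : E' →L[ℂ] HilbertTensor E H) : Prop :=
  ∀ x, HasSum (fun i => hilbertTmul (v i) (A i x)) (V x)

theorem hasSum_norm_sq_of_hasSum_hilbertTmul (hv : Orthonormal ℂ v) {h : ι → H}
    {ξ : HilbertTensor E H} (hξ : HasSum (fun i => hilbertTmul (v i) (h i)) ξ) :
    HasSum (fun i => ‖h i‖ ^ 2) (‖ξ‖ ^ 2) :=
  (hξ.norm.pow 2).congr fun s => (orthogonalFamily_hilbertTmulLI hv).norm_sum h s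

theorem exists_isColumn (hv : Orthonormal ℂ v) {C : ℝ}
    (hA : ∀ x, ∃ s ≤ C * ‖x‖ ^ 2, HasSum (fun i => ‖A i x‖ ^ 2) s) :
    ∃ V, IsColumn v A V := by
  have hsum (x : E') :
      HasSum (fun i => hilbertTmul (v i) (A i x)) (∑' i, hilbertTmul (v i) (A i x)) := by
    obtain ⟨s, -, hs⟩ := hA x
    exact (((orthogonalFamily_hilbertTmulLI hv).summable_iff_norm_sq_summable
      fun i => A i x).2 hs.summable).hasSum
  have hnorm (x : E') : ‖∑' i, hilbertTmul (v i) (A i x)‖ ≤ √C * ‖x‖ := by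
    obtain ⟨s, hle, hs⟩ := hA x
    rw [← (hasSum_norm_sq_of_hasSum_hilbertTmul hv (hsum x)).unique hs] at hle
    calc ‖∑' i, hilbertTmul (v i) (A i x)‖ ≤ √(C * ‖x‖ ^ 2) := Real.le_sqrt_of_sq_le hle
      _ = √C * ‖x‖ := by rw [Real.sqrt_mul' _ (sq_nonneg _), Real.sqrt_sq (norm_nonneg x)]
  exact ⟨LinearMap.mkContinuous
    { toFun := fun x => ∑' i, hilbertTmul (v i) (A i x)
      map_add' := fun x y => (hsum (x + y)).unique (by
        simpa only [map_add] using (hsum x).add (hsum y))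
      map_smul' := fun c x => (hsum (c • x)).unique (by
        simpa only [map_smul, RingHom.id_apply] using (hsum x).const_smul c) } (√C) hnorm, hsum⟩

theorem IsColumn.inner_hilbertTmul (hv : Orthonormal ℂ v) (hV : IsColumn v A V) (i : ι) (h : H)
    (x : E') : inner ℂ (hilbertTmul (v i) h) (V x) = inner ℂ h (A i x) := by
  have hsum : HasSum (fun j => inner ℂ (v i) (v j) * inner ℂ h (A j x))
      (inner ℂ (hilbertTmul (v i) h) (V x)) := by
    simpa using (innerSL ℂ (hilbertTmul (v i) h)).hasSum (hV x)
  have hzero (j : ι) (hj : j ≠ i) : inner ℂ (v i) (v j) * inner ℂ h (A j x) = 0 := by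
    rw [hv.inner_eq_zero hj.symm, zero_mul]
  simpa [hv.norm_eq_one i] using hsum.unique (hasSum_single i hzero)

theorem IsColumn.hasSum_inner {E'' : Type*} [NormedAddCommGroup E''] [InnerProductSpace ℂ E'']
    (hv : Orthonormal ℂ v) (hV : IsColumn v A V) {B : ι → E'' →L[ℂ] H}
    {U : E'' →L[ℂ] HilbertTensor E H} (hU : IsColumn v B U) (x : E') (y : E'') :
    HasSum (fun i => inner ℂ (B i y) (A i x)) (inner ℂ (U y) (V x)) := by
  refine ((innerSL ℂ (U y)).hasSum (hV x)).congr_fun fun i => ?_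
  rw [innerSL_apply_apply, ← inner_conj_symm (U y), hU.inner_hilbertTmul hv, inner_conj_symm]

theorem IsColumn.lTensor {H' : Type*} [NormedAddCommGroup H'] [InnerProductSpace ℂ H']
    (hV : IsColumn v A V) (Y : H →L[ℂ] H') :
    IsColumn v (fun i => Y ∘L A i) ((Y.lTensor E).completion ∘L V) := fun x => by
  simpa [hilbertTmul_apply, completion_apply_coe] using (Y.lTensor E).completion.hasSum (hV x)

theorem IsColumn.adjoint_hilbertTmul [CompleteSpace E'] [CompleteSpace H] (hv : Orthonormal ℂ v)
    (hV : IsColumn v A V) (i : ι) (h : H) :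
    adjoint V (hilbertTmul (v i) h) = adjoint (A i) h :=
  ext_inner_right ℂ fun x => by
    rw [adjoint_inner_left, adjoint_inner_left, hV.inner_hilbertTmul hv]

end Columns

section FockBasis

variable {n : ℕ}

theorem inner_fockBasis_left (α : List (Fin n)) (x : Fock n) : inner ℂ (fockBasis α) x = x α := by
  simp [fockBasis, lp.inner_single_left]

theorem orthonormal_lp_single {ι : Type*} [DecidableEq ι] :
    Orthonormal ℂ fun i : ι => (lp.single 2 i 1 : lp (fun _ : ι => ℂ) 2) := by
  rw [orthonormal_iff_ite]
  intro i j
  simp [lp.inner_single_left, lp.single_apply, Pi.single_apply]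

theorem orthonormal_fockBasis : Orthonormal ℂ (fockBasis (n := n)) :=
  orthonormal_lp_single

theorem hasSum_fockBasis (x : Fock n) : HasSum (fun α => x α • fockBasis α) x := by
  refine (lp.hasSum_single (p := 2) (by simp) x).congr_fun fun α => ?_
  rw [fockBasis, ← lp.single_smul, smul_eq_mul, mul_one]

theorem dense_span_fockBasis :
    Dense (Submodule.span ℂ (Set.range (fockBasis (n := n))) : Set (Fock n)) := fun x =>
  mem_closure_of_tendsto (hasSum_fockBasis x) <| .of_forall fun _ =>
    Submodule.sum_mem _ fun α _ => Submodule.smul_mem _ _ (Submodule.subset_span ⟨α, rfl⟩)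

end FockBasis

section Phi

variable {n : ℕ} {H : Type*} [NormedAddCommGroup H] [InnerProductSpace ℂ H]

theorem wordOp_append (X : Fin n → H →L[ℂ] H) (α β : List (Fin n)) :
    wordOp X (α ++ β) = wordOp X α ∘L wordOp X β := by
  simp [wordOp, ContinuousLinearMap.mul_def]

variable [CompleteSpace H]

theorem adjoint_wordOp_append (X : Fin n → H →L[ℂ] H) (α β : List (Fin n)) :
    adjoint (wordOp X (α ++ β)) = adjoint (wordOp X β) ∘L adjoint (wordOp X α) := by
  rw [wordOp_append, adjoint_comp]

theorem hasSum_wot_iff {ι : Type*} {A : ι → H →WOT[ℂ] H} {B : H →WOT[ℂ] H} :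
    HasSum A B ↔ ∀ x y, HasSum (fun i => inner ℂ y (A i x)) (inner ℂ y (B x)) := by
  let ev (x y : H) : (H →WOT[ℂ] H) →+ ℂ := AddMonoidHom.mk' (fun A => inner ℂ y (A x)) (by simp)
  have inner_sum (x y : H) (s : Finset ι) :
      inner ℂ y ((∑ i ∈ s, A i) x) = ∑ i ∈ s, inner ℂ y (A i x) := map_sum (ev x y) A s
  simp only [HasSum, ContinuousLinearMapWOT.tendsto_iff_forall_inner_apply_tendsto, inner_sum]

variable {f : PosRegularSeries n} {X : Fin n → H →L[ℂ] H} {Y : H →L[ℂ] H}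

theorem inner_phiTerm (α : List (Fin n)) (x y : H) :
    inner ℂ y (phiTerm f X Y α x) =
      f.a α * inner ℂ (adjoint (wordOp X α) y) (Y (adjoint (wordOp X α) x)) := by
  change inner ℂ y ((f.a α : ℂ) • wordOp X α (Y (adjoint (wordOp X α) x))) = _
  rw [inner_smul_right, adjoint_inner_left]

theorem exists_isColumn_sqrt_smul_adjoint_wordOp (hX : Summable (phiTerm f X 1)) :
    ∃ V, IsColumn fockBasis (fun α => (√(f.a α) : ℂ) • adjoint (wordOp X α)) V := by
  obtain ⟨L, hL⟩ := hX
  refine exists_isColumn orthonormal_fockBasis (C := ‖L.toCLM‖) fun x =>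
    ⟨(inner ℂ x (L x)).re, ?_, ?_⟩
  · calc (inner ℂ x (L x)).re ≤ ‖inner ℂ x (L.toCLM x)‖ := Complex.re_le_norm _
      _ ≤ ‖x‖ * (‖L.toCLM‖ * ‖x‖) :=
        (norm_inner_le_norm _ _).trans (by gcongr; exact L.toCLM.le_opNorm x)
      _ = ‖L.toCLM‖ * ‖x‖ ^ 2 := by ring
  · refine (Complex.hasSum_re (hasSum_wot_iff.1 hL x x)).congr_fun fun α => ?_
    rw [inner_phiTerm, Complex.re_ofReal_mul, one_apply_eq_self, ← RCLike.re_eq_complex_re,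
      inner_self_eq_norm_sq, _root_.smul_apply, norm_smul, mul_pow, Complex.norm_real,
      Real.norm_of_nonneg (Real.sqrt_nonneg _), Real.sq_sqrt (f.nonneg α)]

theorem hasSum_phiTerm (hX : Summable (phiTerm f X 1)) (Y : H →L[ℂ] H) :
    HasSum (phiTerm f X Y) (.ofCLM (phi f X Y)) := by
  obtain ⟨V, hV⟩ := exists_isColumn_sqrt_smul_adjoint_wordOp hX
  have hsum : HasSum (phiTerm f X Y)
      (.ofCLM (adjoint V ∘L (Y.lTensor (Fock n)).completion ∘L V)) := by
    refine hasSum_wot_iff.2 fun x y => ?_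
    change HasSum _ (inner ℂ y (adjoint V (((Y.lTensor (Fock n)).completion ∘L V) x)))
    rw [adjoint_inner_right]
    refine ((hV.lTensor Y).hasSum_inner orthonormal_fockBasis hV x y).congr_fun fun α => ?_
    simp only [inner_phiTerm, ContinuousLinearMap.comp_apply, _root_.smul_apply, map_smul,
      inner_smul_left, inner_smul_right, Complex.conj_ofReal]
    rw [← mul_assoc, ← Complex.ofReal_mul, Real.mul_self_sqrt (f.nonneg α)]
  rw [phi, hsum.tsum_eq]
  exact hsum

theorem hasSum_inner_phi (hX : Summable (phiTerm f X 1)) (Y : H →L[ℂ] H) (x y : H) :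
    HasSum (fun α => (f.a α : ℂ) *
      inner ℂ (adjoint (wordOp X α) y) (Y (adjoint (wordOp X α) x)))
      (inner ℂ y (phi f X Y x)) := by
  simpa only [inner_phiTerm] using! hasSum_wot_iff.1 (hasSum_phiTerm hX Y) x y

theorem phi_sub (hX : Summable (phiTerm f X 1)) (Y Z : H →L[ℂ] H) :
    phi f X (Y - Z) = phi f X Y - phi f X Z := by
  ext x
  refine ext_inner_left ℂ fun y => (hasSum_inner_phi hX (Y - Z) x y).unique ?_
  simpa only [_root_.sub_apply, inner_sub_right, mul_sub] using
    (hasSum_inner_phi hX Y x y).sub (hasSum_inner_phi hX Z x y)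

theorem phi_iterate_sub (hX : Summable (phiTerm f X 1)) (j : ℕ) (Y Z : H →L[ℂ] H) :
    (phi f X)^[j] (Y - Z) = (phi f X)^[j] Y - (phi f X)^[j] Z :=
  iterate_map_sub (AddMonoidHom.ofMapSub (phi f X) (phi_sub hX)) j Y Z

theorem hasSum_reApplyInnerSelf_phi (hX : Summable (phiTerm f X 1)) (Y : H →L[ℂ] H) (x : H) :
    HasSum (fun α => f.a α * Y.reApplyInnerSelf (adjoint (wordOp X α) x))
      ((phi f X Y).reApplyInnerSelf x) := by
  have re_inner (Z : H →L[ℂ] H) (z : H) : (inner ℂ z (Z z)).re = Z.reApplyInnerSelf z :=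
    inner_re_symm (𝕜 := ℂ) _ _
  simpa only [Complex.re_ofReal_mul, re_inner] using
    Complex.hasSum_re (hasSum_inner_phi hX Y x x)

theorem isPositive_phi (hX : Summable (phiTerm f X 1)) (hY : Y.IsPositive) :
    (phi f X Y).IsPositive := by
  refine ⟨fun x y => ?_, fun x => (hasSum_reApplyInnerSelf_phi hX Y x).nonneg fun α =>
    mul_nonneg (f.nonneg α) (hY.2 _)⟩
  have hconj := Complex.hasSum_conj'.2 (hasSum_inner_phi hX Y x y)
  simp only [map_mul, Complex.conj_ofReal, inner_conj_symm] at hconj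
  refine hconj.unique ((hasSum_inner_phi hX Y y x).congr_fun fun α => ?_)
  rw [hY.1.apply_clm]

theorem isPositive_phi_iterate (hX : Summable (phiTerm f X 1)) (hY : Y.IsPositive) (j : ℕ) :
    ((phi f X)^[j] Y).IsPositive :=
  Function.Iterate.rec _ hY (fun _ => isPositive_phi hX) j

theorem ofReal_reApplyInnerSelf_phi_iterate (hX : Summable (phiTerm f X 1)) (hY : Y.IsPositive)
    (j : ℕ) (x : H) :
    ENNReal.ofReal (((phi f X)^[j] Y).reApplyInnerSelf x) =
      ∑' w : Fin j → List (Fin n), ENNReal.ofReal ((List.ofFn w).map f.a).prod *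
        ENNReal.ofReal (Y.reApplyInnerSelf (adjoint (wordOp X (List.ofFn w).flatten) x)) := by
  induction j generalizing x with
  | zero => simp [wordOp, ← ContinuousLinearMap.star_eq_adjoint]
  | succ j ih =>
    have hpos := (isPositive_phi_iterate hX hY j).2
    have hs := hasSum_reApplyInnerSelf_phi hX ((phi f X)^[j] Y) x
    rw [Function.iterate_succ_apply', ← hs.tsum_eq,
      ENNReal.ofReal_tsum_of_nonneg (fun α => mul_nonneg (f.nonneg α) (hpos _)) hs.summable,
      ← (Fin.consEquiv fun _ : Fin (j + 1) => List (Fin n)).tsum_eq, ENNReal.tsum_prod']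
    refine tsum_congr fun γ => ?_
    rw [ENNReal.ofReal_mul (f.nonneg γ), ih, ← ENNReal.tsum_mul_left]
    refine tsum_congr fun w => ?_
    simp only [Fin.consEquiv, Equiv.coe_fn_mk, List.ofFn_cons, List.map_cons, List.prod_cons,
      List.flatten_cons]
    rw [ENNReal.ofReal_mul (f.nonneg γ), mul_assoc, adjoint_wordOp_append,
      ContinuousLinearMap.comp_apply]

end Phi

section Factorizations

variable {n : ℕ}

theorem splitWrtComposition_sigma_injective {X : Type*} :
    Function.Injective fun s : (Σ α : List X, Composition α.length) =>
      s.1.splitWrtComposition s.2 := by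
  rintro ⟨α, c⟩ ⟨β, d⟩ h
  simp only at h
  obtain rfl : α = β := by
    rw [← List.flatten_splitWrtComposition α c, h, List.flatten_splitWrtComposition]
  obtain rfl : c = d := Composition.ext <| by
    rw [← List.map_length_splitWrtComposition α c, h, List.map_length_splitWrtComposition]
  rfl

theorem mem_range_splitWrtComposition {X : Type*} {L : List (List X)} (hL : [] ∉ L) :
    L ∈ Set.range fun s : (Σ α : List X, Composition α.length) =>
      s.1.splitWrtComposition s.2 := by
  refine ⟨⟨L.flatten, ⟨L.map List.length, fun hi => ?_, by simp [List.length_flatten]⟩⟩,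
    List.splitWrtComposition_flatten L _ rfl⟩
  obtain ⟨γ, hγ, rfl⟩ := List.mem_map.1 hi
  exact List.length_pos_iff.2 fun h => hL (h ▸ hγ)

theorem prod_map_coeff_nonneg (f : PosRegularSeries n) (L : List (List (Fin n))) :
    0 ≤ (L.map f.a).prod :=
  List.prod_nonneg <| List.forall_mem_map.2 fun γ _ => f.nonneg γ

theorem tsum_bCoeff_mul (f : PosRegularSeries n) (m : ℕ) (t : List (Fin n) → ENNReal) :
    ∑' α, ENNReal.ofReal (bCoeff f m α) * t α =
      ∑' L : List (List (Fin n)), ENNReal.ofReal (L.map f.a).prod *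
        ((L.length + m - 1).choose (m - 1) : ENNReal) * t L.flatten := by
  rw [← splitWrtComposition_sigma_injective.tsum_eq, ENNReal.tsum_sigma']
  · refine tsum_congr fun α => ?_
    rw [tsum_fintype, bCoeff, ENNReal.ofReal_sum_of_nonneg
      (fun c _ => mul_nonneg (prod_map_coeff_nonneg f _) (Nat.cast_nonneg _)), Finset.sum_mul]
    refine Finset.sum_congr rfl fun c _ => ?_
    rw [ENNReal.ofReal_mul (prod_map_coeff_nonneg f _), ENNReal.ofReal_natCast,
      List.flatten_splitWrtComposition, List.length_splitWrtComposition]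
  · intro L hL
    refine mem_range_splitWrtComposition fun h => hL ?_
    simp [List.prod_eq_zero (List.mem_map.2 ⟨[], h, f.nil⟩)]

variable {H : Type*} [NormedAddCommGroup H] [InnerProductSpace ℂ H] [CompleteSpace H]
  {f : PosRegularSeries n} {X : Fin n → H →L[ℂ] H} {Y : H →L[ℂ] H}

theorem tsum_bCoeff_mul_reApplyInnerSelf (m : ℕ) (hX : Summable (phiTerm f X 1))
    (hY : Y.IsPositive) (x : H) :
    ∑' α, ENNReal.ofReal (bCoeff f m α) *
        ENNReal.ofReal (Y.reApplyInnerSelf (adjoint (wordOp X α) x)) =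
      ∑' j : ℕ, ((j + m - 1).choose (m - 1) : ENNReal) *
        ENNReal.ofReal (((phi f X)^[j] Y).reApplyInnerSelf x) := by
  rw [tsum_bCoeff_mul f m fun α => ENNReal.ofReal (Y.reApplyInnerSelf (adjoint (wordOp X α) x)),
    ← (List.equivSigmaTuple (α := List (Fin n))).symm.tsum_eq, ENNReal.tsum_sigma']
  refine tsum_congr fun j => ?_
  rw [ofReal_reApplyInnerSelf_phi_iterate hX hY, ← ENNReal.tsum_mul_left]
  refine tsum_congr fun w => ?_
  simp only [List.equivSigmaTuple, Equiv.coe_fn_symm_mk, List.length_ofFn]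
  ring

end Factorizations

section IteratedDifferences

open Finset.HasAntidiagonal in
theorem tsum_mul_tsum_add (c u : ℕ → ENNReal) :
    ∑' j, c j * ∑' i, u (j + i) = ∑' s, (∑ j ∈ Finset.range (s + 1), c j) * u s := by
  calc ∑' j, c j * ∑' i, u (j + i) = ∑' p : ℕ × ℕ, c p.1 * u (p.1 + p.2) := by
        simp only [← ENNReal.tsum_mul_left]
        exact (ENNReal.tsum_prod (f := fun j i => c j * u (j + i))).symm
    _ = ∑' s, ∑' p : antidiagonal s, c p.1.1 * u (p.1.1 + p.1.2) := by
        rw [← (sigmaAntidiagonalEquivProd (A := ℕ)).tsum_eq, ENNReal.tsum_sigma']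
        rfl
    _ = ∑' s, (∑ j ∈ Finset.range (s + 1), c j) * u s := by
        refine tsum_congr fun s => ?_
        rw [Finset.tsum_subtype (antidiagonal s) fun p => c p.1 * u (p.1 + p.2),
          Finset.sum_mul, ← Finset.Nat.sum_antidiagonal_eq_sum_range_succ fun i _ => c i * u s]
        refine Finset.sum_congr rfl fun p hp => ?_
        rw [mem_antidiagonal.1 hp]

theorem tsum_ofReal_sub_succ {u : ℕ → ℝ} (hu : Antitone u) (hlim : Tendsto u atTop (𝓝 0))
    (j : ℕ) : ∑' i, ENNReal.ofReal (u (j + i) - u (j + i + 1)) = ENNReal.ofReal (u j) := by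
  have hnonneg (i : ℕ) : 0 ≤ u (j + i) - u (j + i + 1) := sub_nonneg.2 (hu (Nat.le_succ _))
  have hsum : HasSum (fun i => u (j + i) - u (j + i + 1)) (u j) := by
    rw [hasSum_iff_tendsto_nat_of_nonneg hnonneg]
    have hshift : Tendsto (fun N => u (j + N)) atTop (𝓝 0) := by
      simpa only [add_comm j] using (tendsto_add_atTop_iff_nat j).2 hlim
    have htelescope (N : ℕ) :
        ∑ i ∈ Finset.range N, (u (j + i) - u (j + i + 1)) = u j - u (j + N) :=
      Finset.sum_range_sub' (fun i => u (j + i)) N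
    simpa only [htelescope, sub_zero] using hshift.const_sub (u j)
  rw [← ENNReal.ofReal_tsum_of_nonneg hnonneg hsum.summable, hsum.tsum_eq]

theorem tsum_choose_mul_ofReal_iterated_sub {q : ℕ → ℕ → ℝ} (m : ℕ)
    (hq : ∀ k ≤ m + 1, ∀ j, 0 ≤ q k j) (hsub : ∀ k j, q (k + 1) j = q k j - q k (j + 1))
    (hlim : Tendsto (q 0) atTop (𝓝 0)) :
    ∑' j : ℕ, ((j + m).choose m : ENNReal) * ENNReal.ofReal (q (m + 1) j) =
      ENNReal.ofReal (q 0 0) := by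
  have hlim (k : ℕ) : Tendsto (q k) atTop (𝓝 0) := by
    induction k with
    | zero => exact hlim
    | succ k ih =>
      rw [funext (hsub k)]
      simpa using ih.sub (ih.comp (tendsto_add_atTop_nat 1))
  have htail (k : ℕ) (hk : k ≤ m) (j : ℕ) :
      ENNReal.ofReal (q k j) = ∑' i, ENNReal.ofReal (q (k + 1) (j + i)) := by
    simp only [hsub k]
    refine (tsum_ofReal_sub_succ (antitone_nat_of_succ_le fun i => ?_) (hlim k) j).symm
    exact sub_nonneg.1 (hsub k i ▸ hq (k + 1) (by omega) i)
  induction m with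
  | zero => simp [htail 0 le_rfl 0]
  | succ m ih =>
    rw [← ih (fun k hk => hq k (by omega)) fun k hk => htail k (by omega)]
    simp only [htail (m + 1) le_rfl]
    rw [tsum_mul_tsum_add (fun j => ((j + m).choose m : ENNReal))
      fun i => ENNReal.ofReal (q (m + 1 + 1) i)]
    refine tsum_congr fun s => ?_
    rw [← Nat.cast_sum, Nat.sum_range_add_choose, add_assoc s]

end IteratedDifferences

section BerezinKernel

variable {n m : ℕ} {H : Type*} [NormedAddCommGroup H] [InnerProductSpace ℂ H] [CompleteSpace H]
  {f : PosRegularSeries n} {T : Fin n → H →L[ℂ] H}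

theorem isPositive_defectPow (hT : T ∈ ncDomain f m H) {k : ℕ} (hk : k ≤ m) :
    (defectPow f k T).IsPositive := by
  rcases Nat.eq_zero_or_pos k with rfl | hk₀
  · exact isPositive_one
  · exact hT.2 k hk₀ hk

theorem tsum_bCoeff_mul_defectPow (hm : 1 ≤ m) (hT : T ∈ ncDomain f m H) (hpure : IsPure f T)
    (x : H) :
    ∑' α, ENNReal.ofReal (bCoeff f m α) *
        ENNReal.ofReal ((defectPow f m T).reApplyInnerSelf (adjoint (wordOp T α) x)) =
      ENNReal.ofReal (‖x‖ ^ 2) := by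
  let q (k j : ℕ) : ℝ := ((phi f T)^[j] (defectPow f k T)).reApplyInnerSelf x
  have hq (k : ℕ) (hk : k ≤ m) (j : ℕ) : 0 ≤ q k j :=
    (isPositive_phi_iterate hT.1 (isPositive_defectPow hT hk) j).2 x
  have hsub (k j : ℕ) : q (k + 1) j = q k j - q k (j + 1) := by
    have hsucc : defectPow f (k + 1) T = defectPow f k T - phi f T (defectPow f k T) :=
      Function.iterate_succ_apply' _ _ _
    simp only [q, hsucc, phi_iterate_sub hT.1, ← Function.iterate_succ_apply]
    simp [reApplyInnerSelf_apply, inner_sub_left]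
  have hlim : Tendsto (q 0) atTop (𝓝 0) := by
    simpa [Function.comp_def, q, reApplyInnerSelf_apply, defectPow] using
      (Complex.continuous_re.tendsto _).comp ((hpure x).inner (tendsto_const_nhds (x := x)))
  have hq₀ : q 0 0 = ‖x‖ ^ 2 := by
    simp [q, defectPow, reApplyInnerSelf_apply, inner_self_eq_norm_sq_to_K, ← Complex.ofReal_pow]
  obtain ⟨k, rfl⟩ : ∃ k, m = k + 1 := ⟨m - 1, by omega⟩
  rw [tsum_bCoeff_mul_reApplyInnerSelf _ hT.1 (isPositive_defectPow hT le_rfl), ← hq₀]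
  exact tsum_choose_mul_ofReal_iterated_sub k hq hsub hlim

theorem hasSum_of_tsum_ofReal {ι : Type*} {F : ι → ℝ} {s : ℝ} (hF : ∀ i, 0 ≤ F i) (hs : 0 ≤ s)
    (h : ∑' i, ENNReal.ofReal (F i) = ENNReal.ofReal s) : HasSum F s := by
  have hsum := ENNReal.hasSum_toReal (h.trans_ne ENNReal.ofReal_ne_top)
  rw [← ENNReal.tsum_toReal_eq fun _ => ENNReal.ofReal_ne_top, h, ENNReal.toReal_ofReal hs] at hsum
  simpa only [ENNReal.toReal_ofReal (hF _)] using hsum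

theorem isSelfAdjoint_defectOp : IsSelfAdjoint (defectOp f m T) :=
  (CFC.sqrt_nonneg _).isSelfAdjoint

theorem norm_defectOp_apply_sq (h : (defectPow f m T).IsPositive) (x : H) :
    ‖defectOp f m T x‖ ^ 2 = (defectPow f m T).reApplyInnerSelf x := by
  have hsq : defectOp f m T * defectOp f m T = defectPow f m T :=
    CFC.sqrt_mul_sqrt_self _ ((ContinuousLinearMap.nonneg_iff_isPositive _).2 h)
  rw [← hsq, reApplyInnerSelf_apply, mul_apply_eq_comp, ← adjoint_inner_right,
    isSelfAdjoint_defectOp.adjoint_eq, inner_self_eq_norm_sq]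

/-- The coordinate `h ↦ √b_α Δ T_α* h` of the Berezin kernel at `e_α`. -/
def kernelEntry (f : PosRegularSeries n) (m : ℕ) (T : Fin n → H →L[ℂ] H) (α : List (Fin n)) :
    H →L[ℂ] H :=
  (√(bCoeff f m α) : ℂ) • (defectOp f m T ∘L adjoint (wordOp T α))

theorem kernelTerm_eq (h : H) (α : List (Fin n)) :
    kernelTerm f m T h α = hilbertTmul (fockBasis α) (kernelEntry f m T α h) := by
  simp only [kernelTerm, hilbertTmul_apply, kernelEntry, _root_.smul_apply,
    TensorProduct.smul_tmul, ContinuousLinearMap.comp_apply]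

theorem hasSum_norm_sq_kernelEntry (hm : 1 ≤ m) (hT : T ∈ ncDomain f m H) (hpure : IsPure f T)
    (x : H) : HasSum (fun α => ‖kernelEntry f m T α x‖ ^ 2) (‖x‖ ^ 2) := by
  refine hasSum_of_tsum_ofReal (fun _ => sq_nonneg _) (sq_nonneg _) ?_
  rw [← tsum_bCoeff_mul_defectPow hm hT hpure x]
  refine tsum_congr fun α => ?_
  rw [← norm_defectOp_apply_sq (isPositive_defectPow hT le_rfl),
    ← ENNReal.ofReal_mul (bCoeff_pos f m α).le, kernelEntry, _root_.smul_apply, norm_smul, mul_pow,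
    Complex.norm_real, Real.norm_of_nonneg (Real.sqrt_nonneg _), Real.sq_sqrt (bCoeff_pos f m α).le,
    ContinuousLinearMap.comp_apply]

theorem hasSum_kernelTerm (hm : 1 ≤ m) (hT : T ∈ ncDomain f m H) (hpure : IsPure f T) (h : H) :
    HasSum (kernelTerm f m T h) (berezinKernel f m T h) := by
  have hK : ∃ K : H →L[ℂ] FockTensor n H, ∀ h, HasSum (kernelTerm f m T h) (K h) := by
    obtain ⟨V, hV⟩ := exists_isColumn orthonormal_fockBasis (A := kernelEntry f m T) (C := 1)
      fun x => ⟨_, (one_mul _).ge, hasSum_norm_sq_kernelEntry hm hT hpure x⟩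
    exact ⟨V, fun h => (hV h).congr_fun (kernelTerm_eq h)⟩
  rw [berezinKernel, dif_pos hK]
  exact hK.choose_spec h

theorem isColumn_berezinKernel (hm : 1 ≤ m) (hT : T ∈ ncDomain f m H) (hpure : IsPure f T) :
    IsColumn fockBasis (kernelEntry f m T) (berezinKernel f m T) := fun h =>
  (hasSum_kernelTerm hm hT hpure h).congr_fun fun α => (kernelTerm_eq h α).symm

theorem norm_berezinKernel_apply (hm : 1 ≤ m) (hT : T ∈ ncDomain f m H) (hpure : IsPure f T)
    (h : H) : ‖berezinKernel f m T h‖ = ‖h‖ := by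
  have hnorm := hasSum_norm_sq_of_hasSum_hilbertTmul orthonormal_fockBasis
    (isColumn_berezinKernel hm hT hpure h)
  exact (sq_eq_sq₀ (norm_nonneg _) (norm_nonneg _)).1
    (hnorm.unique (hasSum_norm_sq_kernelEntry hm hT hpure h))

end BerezinKernel

section Intertwining

variable {n : ℕ} (f : PosRegularSeries n) (m : ℕ)

/-- The vector `e_α / √b_α`, the normalization in which `W_β` acts by `α ↦ βα`. -/
def fockMonomial (α : List (Fin n)) : Fock n := (√(bCoeff f m α) : ℂ)⁻¹ • fockBasis α

theorem sqrt_bCoeff_ne_zero (α : List (Fin n)) : (√(bCoeff f m α) : ℂ) ≠ 0 :=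
  Complex.ofReal_ne_zero.2 (Real.sqrt_pos.2 (bCoeff_pos f m α)).ne'

theorem fockBasis_eq_smul_fockMonomial (α : List (Fin n)) :
    fockBasis α = (√(bCoeff f m α) : ℂ) • fockMonomial f m α := by
  rw [fockMonomial, smul_inv_smul₀ (sqrt_bCoeff_ne_zero f m α)]

theorem span_fockMonomial :
    Submodule.span ℂ (Set.range (fockMonomial f m)) = Submodule.span ℂ (Set.range fockBasis) := by
  refine le_antisymm ?_ ?_ <;> rw [Submodule.span_le] <;> rintro _ ⟨α, rfl⟩
  · exact Submodule.smul_mem _ _ (Submodule.subset_span ⟨α, rfl⟩)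
  · rw [fockBasis_eq_smul_fockMonomial f m]
    exact Submodule.smul_mem _ _ (Submodule.subset_span ⟨α, rfl⟩)

theorem dense_span_fockMonomial :
    Dense (Submodule.span ℂ (Set.range (fockMonomial f m)) : Set (Fock n)) := by
  rw [span_fockMonomial]
  exact dense_span_fockBasis

theorem weightedShift_fockMonomial (i : Fin n) (α : List (Fin n)) :
    weightedShift f m i (fockMonomial f m α) = fockMonomial f m (i :: α) := by
  rw [fockMonomial, map_smul, weightedShift_basis, smul_smul, shiftWeight, Complex.ofReal_div,
    mul_div, inv_mul_cancel₀ (sqrt_bCoeff_ne_zero f m α), one_div, fockMonomial]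

theorem wordOp_weightedShift_fockMonomial (β α : List (Fin n)) :
    wordOp (weightedShift f m) β (fockMonomial f m α) = fockMonomial f m (β ++ α) := by
  induction β with
  | nil => simp [wordOp]
  | cons i β ih =>
    rw [← List.singleton_append, wordOp_append, ContinuousLinearMap.comp_apply, ih]
    simp [wordOp, weightedShift_fockMonomial]

variable {f m} {H : Type*} [NormedAddCommGroup H] [InnerProductSpace ℂ H] [CompleteSpace H]
  {T : Fin n → H →L[ℂ] H} {K : H →L[ℂ] FockTensor n H}

theorem adjoint_kernel_hilbertTmul_fockMonomial (hK : IsColumn fockBasis (kernelEntry f m T) K)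
    (α : List (Fin n)) (h : H) :
    adjoint K (hilbertTmul (fockMonomial f m α) h) = wordOp T α (defectOp f m T h) := by
  rw [fockMonomial, map_smul, _root_.smul_apply, map_smul,
    hK.adjoint_hilbertTmul orthonormal_fockBasis, kernelEntry, map_smulₛₗ, adjoint_comp,
    adjoint_adjoint, isSelfAdjoint_defectOp.adjoint_eq, Complex.conj_ofReal, _root_.smul_apply,
    inv_smul_smul₀ (sqrt_bCoeff_ne_zero f m α), ContinuousLinearMap.comp_apply]

theorem adjoint_kernel_comp_ampliationL_wordOp (hK : IsColumn fockBasis (kernelEntry f m T) K)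
    (β : List (Fin n)) :
    adjoint K ∘L ampliationL H (wordOp (weightedShift f m) β) = wordOp T β ∘L adjoint K := by
  refine ContinuousLinearMap.ext_on
    (dense_span_hilbertTmul (H := H) (dense_span_fockMonomial f m)) ?_
  rintro _ ⟨_, ⟨α, rfl⟩, h, -, rfl⟩
  simp only [ContinuousLinearMap.comp_apply, ampliationL_hilbertTmul,
    wordOp_weightedShift_fockMonomial, adjoint_kernel_hilbertTmul_fockMonomial hK, wordOp_append]

end Intertwining

section HardyAlgebra

variable {n : ℕ} (f : PosRegularSeries n) (m : ℕ)

/-- The coordinate functional at `ω` relative to the vectors `fockMonomial f m α`. -/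
def fockMonomialCoord (ω : List (Fin n)) : Fock n →L[ℂ] ℂ :=
  (√(bCoeff f m ω) : ℂ) • innerSL ℂ (fockBasis ω)

theorem fockMonomialCoord_apply (ω : List (Fin n)) (x : Fock n) :
    fockMonomialCoord f m ω x = √(bCoeff f m ω) * x ω := by
  simp [fockMonomialCoord, inner_fockBasis_left]

theorem fockMonomialCoord_fockMonomial (ω α : List (Fin n)) :
    fockMonomialCoord f m ω (fockMonomial f m α) = if ω = α then 1 else 0 := by
  simp only [fockMonomialCoord, fockMonomial, map_smul, _root_.smul_apply, innerSL_apply_apply,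
    orthonormal_iff_ite.1 orthonormal_fockBasis]
  split_ifs with h
  · simp [h, sqrt_bCoeff_ne_zero f m α]
  · simp

theorem hasSum_fockMonomial (x : Fock n) :
    HasSum (fun α => fockMonomialCoord f m α x • fockMonomial f m α) x := by
  refine (hasSum_fockBasis x).congr_fun fun α => ?_
  rw [fockMonomialCoord_apply, fockBasis_eq_smul_fockMonomial f m, smul_smul, mul_comm]

/-- The matrix of `g` relative to the vectors `fockMonomial f m α`. -/
def fockMatrix (g : Fock n →L[ℂ] Fock n) (ω α : List (Fin n)) : ℂ :=
  fockMonomialCoord f m ω (g (fockMonomial f m α))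

theorem hasSum_fockMatrix_mul (g h : Fock n →L[ℂ] Fock n) (ω α : List (Fin n)) :
    HasSum (fun τ => fockMatrix f m g ω τ * fockMatrix f m h τ α) (fockMatrix f m (g * h) ω α) := by
  simpa [fockMatrix, mul_comm] using
    (fockMonomialCoord f m ω ∘L g).hasSum (hasSum_fockMonomial f m (h (fockMonomial f m α)))

/-- `M` is the matrix of left convolution by `c` on words: the entry at `(βα, α)` is `c β`, and the
entries at `(ω, α)` with `α` not a suffix of `ω` vanish. -/
structure IsConvolutionMatrix {X : Type*} (M : List X → List X → ℂ) (c : List X → ℂ) : Prop where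
  append : ∀ β α, M (β ++ α) α = c β
  eq_zero : ∀ {α ω}, ¬ α <:+ ω → M ω α = 0

namespace IsConvolutionMatrix

variable {X : Type*} {M N P : List X → List X → ℂ} {c d : List X → ℂ}

theorem append_append (hM : IsConvolutionMatrix M c) (δ β α : List X) :
    M (δ ++ α) (β ++ α) = M δ β := by
  by_cases hβ : β <:+ δ
  · obtain ⟨γ, rfl⟩ := hβ
    rw [List.append_assoc, hM.append, hM.append]
  · rw [hM.eq_zero hβ, hM.eq_zero (mt List.suffix_append_self_iff.1 hβ)]

theorem mul (hM : IsConvolutionMatrix M c) (hN : IsConvolutionMatrix N d)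
    (hP : ∀ ω α, HasSum (fun τ => M ω τ * N τ α) (P ω α)) :
    IsConvolutionMatrix P fun δ => P δ [] where
  append δ α := by
    have hinj : Function.Injective fun β : List X => β ++ α := List.append_left_injective α
    have hzero (τ : List X) (hτ : τ ∉ Set.range fun β : List X => β ++ α) :
        M (δ ++ α) τ * N τ α = 0 := by
      rw [hN.eq_zero hτ, mul_zero]
    refine ((hinj.hasSum_iff hzero).2 (hP (δ ++ α) α)).unique ((hP δ []).congr_fun fun β => ?_)
    have hNβ := hN.append β []
    rw [List.append_nil] at hNβ
    rw [Function.comp_apply, hM.append_append, hN.append, hNβ]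
  eq_zero {α ω} hα := by
    refine (hP ω α).unique (hasSum_zero.congr_fun fun τ => ?_)
    by_cases hτ : α <:+ τ
    · rw [hM.eq_zero fun h => hα (hτ.trans h), zero_mul]
    · rw [hN.eq_zero hτ, mul_zero]

end IsConvolutionMatrix

variable {f m} {g h : Fock n →L[ℂ] Fock n} {c d : List (Fin n) → ℂ}

theorem HasFourierRep.hasSum_fockMonomial (hg : HasFourierRep f m g c) (α : List (Fin n)) :
    HasSum (fun β => c β • fockMonomial f m (β ++ α)) (g (fockMonomial f m α)) := by
  have hmem : fockMonomial f m α ∈ Submodule.span ℂ (Set.range fockBasis) := by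
    rw [← span_fockMonomial f m]
    exact Submodule.subset_span ⟨α, rfl⟩
  simpa only [wordOp_weightedShift_fockMonomial] using hg.2 _ hmem

theorem HasFourierRep.isConvolutionMatrix (hg : HasFourierRep f m g c) :
    IsConvolutionMatrix (fockMatrix f m g) c := by
  have hsum (ω α : List (Fin n)) :
      HasSum (fun β => c β * if ω = β ++ α then 1 else 0) (fockMatrix f m g ω α) := by
    simpa only [fockMatrix, map_smul, smul_eq_mul, fockMonomialCoord_fockMonomial] using
      (fockMonomialCoord f m ω).hasSum (hg.hasSum_fockMonomial α)
  refine ⟨fun β α => (hsum _ α).unique ?_, fun {α ω} hα => (hsum ω α).unique ?_⟩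
  · refine (hasSum_ite_eq β (c β)).congr_fun fun γ => ?_
    rcases eq_or_ne γ β with rfl | hγ
    · simp
    · simp [hγ, hγ.symm]
  · refine hasSum_zero.congr_fun fun β => ?_
    rw [if_neg (by rintro rfl; exact hα (List.suffix_append β α)), mul_zero]

theorem IsConvolutionMatrix.summable (hg : IsConvolutionMatrix (fockMatrix f m g) c) :
    Summable fun β => ‖c β‖ ^ 2 / bCoeff f m β := by
  have hsum : Summable fun β => ‖g (fockMonomial f m []) β‖ ^ 2 := by
    simpa using (lp.memℓp (g (fockMonomial f m []))).summable (by simp)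
  refine hsum.congr fun β => ?_
  have hβ := hg.append β []
  rw [List.append_nil, fockMatrix, fockMonomialCoord_apply] at hβ
  rw [← hβ, norm_mul, mul_pow, Complex.norm_real, Real.norm_of_nonneg (Real.sqrt_nonneg _),
    Real.sq_sqrt (bCoeff_pos f m β).le, mul_div_cancel_left₀ _ (bCoeff_pos f m β).ne']

theorem hasFourierRep_iff :
    HasFourierRep f m g c ↔ IsConvolutionMatrix (fockMatrix f m g) c := by
  refine ⟨HasFourierRep.isConvolutionMatrix, fun hg => ⟨hg.summable, fun p hp => ?_⟩⟩
  rw [← span_fockMonomial f m] at hp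
  induction hp using Submodule.span_induction with
  | mem p hp =>
    obtain ⟨α, rfl⟩ := hp
    have hzero (ω : List (Fin n)) (hω : ω ∉ Set.range fun β => β ++ α) :
        fockMonomialCoord f m ω (g (fockMonomial f m α)) • fockMonomial f m ω = 0 := by
      rw [← fockMatrix, hg.eq_zero hω, zero_smul]
    refine (((List.append_left_injective α).hasSum_iff hzero).2
      (hasSum_fockMonomial f m (g (fockMonomial f m α)))).congr_fun fun β => ?_
    rw [Function.comp_apply, wordOp_weightedShift_fockMonomial, ← fockMatrix, hg.append]
  | zero => simp
  | add p q _ _ hp hq => simpa using hp.add hq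
  | smul a p _ hp => simpa [smul_comm _ a] using hp.const_smul a

theorem HasFourierRep.mul (hg : HasFourierRep f m g c) (hh : HasFourierRep f m h d) :
    ∃ e, HasFourierRep f m (g * h) e :=
  ⟨_, hasFourierRep_iff.2 <|
    hg.isConvolutionMatrix.mul hh.isConvolutionMatrix (hasSum_fockMatrix_mul f m g h)⟩

theorem HasFourierRep.add (hg : HasFourierRep f m g c) (hh : HasFourierRep f m h d) :
    HasFourierRep f m (g + h) (c + d) := by
  rw [hasFourierRep_iff] at *
  refine ⟨fun β α => ?_, fun hα => ?_⟩ <;>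
    simp only [fockMatrix, _root_.add_apply, map_add, Pi.add_apply]
  · exact congrArg₂ (· + ·) (hg.append β α) (hh.append β α)
  · simpa using! congrArg₂ (· + ·) (hg.eq_zero hα) (hh.eq_zero hα)

theorem HasFourierRep.smul (a : ℂ) (hg : HasFourierRep f m g c) :
    HasFourierRep f m (a • g) (a • c) := by
  rw [hasFourierRep_iff] at *
  refine ⟨fun β α => ?_, fun hα => ?_⟩ <;>
    simp only [fockMatrix, _root_.smul_apply, map_smul, Pi.smul_apply]
  · exact congrArg (a • ·) (hg.append β α)
  · exact smul_eq_zero_of_right a (hg.eq_zero hα)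

variable (f m)

theorem hasFourierRep_wordOp (β : List (Fin n)) :
    HasFourierRep f m (wordOp (weightedShift f m) β) (Pi.single β 1) := by
  refine hasFourierRep_iff.2 ⟨fun γ α => ?_, fun {α ω} hα => ?_⟩ <;>
    rw [fockMatrix, wordOp_weightedShift_fockMonomial, fockMonomialCoord_fockMonomial]
  · simp [Pi.single_apply]
  · rw [if_neg (by rintro rfl; exact hα (List.suffix_append β α))]

/-- The Hardy algebra `F_n^∞(D_f^m)`, as a subalgebra of the bounded operators on the Fock space. -/
def hardyAlgebra : Subalgebra ℂ (Fock n →L[ℂ] Fock n) where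
  carrier := hardySet f m
  mul_mem' := fun ⟨_, hc⟩ ⟨_, hd⟩ => hc.mul hd
  add_mem' := fun ⟨_, hc⟩ ⟨_, hd⟩ => ⟨_, hc.add hd⟩
  algebraMap_mem' := fun a => ⟨_, by
    rw [Algebra.algebraMap_eq_smul_one]
    exact (hasFourierRep_wordOp f m []).smul a⟩

end HardyAlgebra

section SchurMultiplier

variable {ι E L : Type*} [NormedAddCommGroup E] [InnerProductSpace ℂ E]
  [NormedAddCommGroup L] [InnerProductSpace ℂ L] {v : ι → E}

theorem exists_contraction_hilbertTmul (hv : Orthonormal ℂ v) {u : ι → L} (hu : ∀ i, ‖u i‖ ≤ 1) :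
    ∃ J : E →L[ℂ] HilbertTensor E L, ‖J‖ ≤ 1 ∧ ∀ i, J (v i) = hilbertTmul (v i) (u i) := by
  let A (i : ι) : E →L[ℂ] L := (innerSL ℂ (v i)).smulRight (u i)
  have norm_A_sq_le (x : E) (i : ι) : ‖A i x‖ ^ 2 ≤ ‖inner ℂ (v i) x‖ ^ 2 := by
    rw [smulRight_apply, innerSL_apply_apply, norm_smul, mul_pow]
    exact mul_le_of_le_one_right (sq_nonneg _) (pow_le_one₀ (norm_nonneg _) (hu i))
  have summable_A (x : E) : Summable fun i => ‖A i x‖ ^ 2 :=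
    .of_nonneg_of_le (fun i => sq_nonneg _) (norm_A_sq_le x) (hv.inner_products_summable x)
  have tsum_A_le (x : E) : ∑' i, ‖A i x‖ ^ 2 ≤ ‖x‖ ^ 2 :=
    ((summable_A x).tsum_le_tsum (norm_A_sq_le x) (hv.inner_products_summable x)).trans
      (hv.tsum_inner_products_le x)
  obtain ⟨J, hJ⟩ := exists_isColumn (C := 1) hv fun x =>
    ⟨_, (tsum_A_le x).trans_eq (one_mul _).symm, (summable_A x).hasSum⟩
  refine ⟨J, opNorm_le_bound _ zero_le_one fun x => ?_, fun i => ?_⟩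
  · rw [one_mul, ← sq_le_sq₀ (norm_nonneg _) (norm_nonneg _),
      (hasSum_norm_sq_of_hasSum_hilbertTmul hv (hJ x)).tsum_eq.symm]
    exact tsum_A_le x
  · have hzero (j : ι) (hj : j ≠ i) : hilbertTmul (v j) (A j (v i)) = 0 := by
      rw [smulRight_apply, innerSL_apply_apply, hv.inner_eq_zero hj, zero_smul, map_zero]
    simpa [A, hv.norm_eq_one i] using (hJ (v i)).unique (hasSum_single i hzero)

theorem exists_schurMultiplier {κ E' : Type*} [NormedAddCommGroup E'] [InnerProductSpace ℂ E']
    [CompleteSpace E'] {w : κ → E'} (hv : Orthonormal ℂ v) (hw : Orthonormal ℂ w)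
    {s : ι → L} {t : κ → L} (hs : ∀ i, ‖s i‖ ≤ 1) (ht : ∀ k, ‖t k‖ ≤ 1) (A : E →L[ℂ] E') :
    ∃ B : E →L[ℂ] E', ‖B‖ ≤ ‖A‖ ∧
      ∀ k i, inner ℂ (w k) (B (v i)) = inner ℂ (w k) (A (v i)) * inner ℂ (t k) (s i) := by
  obtain ⟨J, hJ, hJv⟩ := exists_contraction_hilbertTmul hv hs
  obtain ⟨J', hJ', hJw⟩ := exists_contraction_hilbertTmul hw ht
  refine ⟨adjoint J' ∘L ampliationL L A ∘L J, ?_, fun k i => ?_⟩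
  · calc ‖adjoint J' ∘L ampliationL L A ∘L J‖
        ≤ ‖adjoint J'‖ * (‖ampliationL L A‖ * ‖J‖) :=
          (opNorm_comp_le _ _).trans (by gcongr; exact opNorm_comp_le _ _)
      _ ≤ 1 * (‖A‖ * 1) := by
          rw [LinearIsometryEquiv.norm_map]
          gcongr
          exact norm_ampliationL_le A
      _ = ‖A‖ := by ring
  · simp [adjoint_inner_right, hJv, hJw]

end SchurMultiplier

section GeometricGram

variable {L : Type*} [NormedAddCommGroup L] [InnerProductSpace ℂ L] {e : ℕ → L}

/-- Unit vectors with Gram matrix `r ^ |i - j|`, built from an orthonormal sequence `e` by an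
autoregressive recursion. -/
def geomVec (e : ℕ → L) (r : ℝ) : ℕ → L
  | 0 => e 0
  | i + 1 => (r : ℂ) • geomVec e r i + (√(1 - r ^ 2) : ℂ) • e (i + 1)

theorem inner_geomVec_of_lt (he : Orthonormal ℂ e) (r : ℝ) {i j : ℕ} (h : i < j) :
    inner ℂ (e j) (geomVec e r i) = 0 := by
  induction i with
  | zero => exact he.inner_eq_zero h.ne'
  | succ i ih =>
    rw [geomVec, inner_add_right, inner_smul_right, inner_smul_right, ih (by omega),
      he.inner_eq_zero h.ne', mul_zero, mul_zero, add_zero]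

theorem norm_geomVec (he : Orthonormal ℂ e) {r : ℝ} (hr : |r| ≤ 1) (i : ℕ) :
    ‖geomVec e r i‖ = 1 := by
  induction i with
  | zero => exact he.norm_eq_one 0
  | succ i ih =>
    have horth : inner ℂ ((r : ℂ) • geomVec e r i) ((√(1 - r ^ 2) : ℂ) • e (i + 1)) = 0 := by
      rw [inner_smul_left, inner_smul_right, ← inner_conj_symm,
        inner_geomVec_of_lt he r i.lt_succ_self, map_zero, mul_zero, mul_zero]
    have hsq : √(1 - r ^ 2) ^ 2 = 1 - r ^ 2 :=
      Real.sq_sqrt (sub_nonneg.2 ((sq_le_one_iff_abs_le_one r).2 hr))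
    rw [← sq_eq_sq₀ (norm_nonneg _) zero_le_one, geomVec, sq,
      norm_add_sq_eq_norm_sq_add_norm_sq_of_inner_eq_zero _ _ horth, norm_smul, norm_smul, ih,
      he.norm_eq_one, Complex.norm_real, Complex.norm_real, mul_one, mul_one,
      Real.norm_eq_abs, Real.norm_eq_abs, abs_mul_abs_self, abs_mul_abs_self, ← sq, ← sq, hsq]
    ring

theorem inner_geomVec_add (he : Orthonormal ℂ e) {r : ℝ} (hr : |r| ≤ 1) (k i : ℕ) :
    inner ℂ (geomVec e r (k + i)) (geomVec e r i) = (r : ℂ) ^ k := by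
  induction k with
  | zero => simp [inner_self_eq_norm_sq_to_K, norm_geomVec he hr]
  | succ k ih =>
    rw [add_right_comm, geomVec, inner_add_left, inner_smul_left, inner_smul_left, ih,
      inner_geomVec_of_lt he r (by omega), Complex.conj_ofReal, mul_zero, add_zero, pow_succ']

end GeometricGram

section Homogeneous

variable {n : ℕ} {H : Type*} [NormedAddCommGroup H] [InnerProductSpace ℂ H]

theorem wordOp_smul (r : ℂ) (X : Fin n → H →L[ℂ] H) (α : List (Fin n)) :
    wordOp (fun i => r • X i) α = r ^ α.length • wordOp X α := by
  induction α with
  | nil => simp [wordOp]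
  | cons i α ih =>
    simp only [wordOp, List.map_cons, List.prod_cons, List.length_cons] at ih ⊢
    rw [ih, smul_mul_smul_comm, pow_succ']

/-- The homogeneous part `∑_{|β| = k} c_β X_β` of degree `k` of the series `∑_β c_β X_β`. -/
def homogeneousPart (c : List (Fin n) → ℂ) (X : Fin n → H →L[ℂ] H) (k : ℕ) : H →L[ℂ] H :=
  ∑ w : Fin k → Fin n, c (List.ofFn w) • wordOp X (List.ofFn w)

theorem ncPartialSum_eq_sum_homogeneousPart (c : List (Fin n) → ℂ) (X : Fin n → H →L[ℂ] H)
    (N : ℕ) : ncPartialSum c X N = ∑ k ∈ Finset.range N, homogeneousPart c X k :=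
  rfl

theorem homogeneousPart_smul (c : List (Fin n) → ℂ) (r : ℂ) (X : Fin n → H →L[ℂ] H) (k : ℕ) :
    homogeneousPart c (fun i => r • X i) k = r ^ k • homogeneousPart c X k := by
  simp only [homogeneousPart, wordOp_smul, List.length_ofFn, Finset.smul_sum, smul_comm (r ^ k)]

theorem ncPartialSum_smul (c : List (Fin n) → ℂ) (r : ℂ) (X : Fin n → H →L[ℂ] H) (N : ℕ) :
    ncPartialSum c (fun i => r • X i) N = ncPartialSum (fun β => r ^ β.length * c β) X N := by
  simp only [ncPartialSum, wordOp_smul, smul_smul, mul_comm]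

end Homogeneous

section Dilation

variable {n m : ℕ} {f : PosRegularSeries n} {g g' : Fock n →L[ℂ] Fock n} {c : List (Fin n) → ℂ}

theorem fockMatrix_eq (f : PosRegularSeries n) (m : ℕ) (g : Fock n →L[ℂ] Fock n)
    (ω α : List (Fin n)) :
    fockMatrix f m g ω α =
      √(bCoeff f m ω) * (√(bCoeff f m α) : ℂ)⁻¹ * inner ℂ (fockBasis ω) (g (fockBasis α)) := by
  simp [fockMatrix, fockMonomialCoord, fockMonomial, mul_assoc, mul_left_comm]

theorem HasFourierRep.exists_radialMultiplier {L : Type*} [NormedAddCommGroup L]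
    [InnerProductSpace ℂ L] {s t : ℕ → L} (hs : ∀ i, ‖s i‖ ≤ 1) (ht : ∀ i, ‖t i‖ ≤ 1) {φ : ℕ → ℂ}
    (hφ : ∀ k i, inner ℂ (t (k + i)) (s i) = φ k) (hg : HasFourierRep f m g c) :
    ∃ g', ‖g'‖ ≤ ‖g‖ ∧ HasFourierRep f m g' fun β => φ β.length * c β := by
  obtain ⟨g', hle, hg'⟩ := exists_schurMultiplier orthonormal_fockBasis orthonormal_fockBasis
    (fun α => hs α.length) (fun ω => ht ω.length) g
  have hmatrix (ω α : List (Fin n)) :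
      fockMatrix f m g' ω α = fockMatrix f m g ω α * inner ℂ (t ω.length) (s α.length) := by
    simp only [fockMatrix_eq, hg', mul_assoc]
  refine ⟨g', hle, hasFourierRep_iff.2 ⟨fun β α => ?_, fun hα => ?_⟩⟩
  · rw [hmatrix, hg.isConvolutionMatrix.append, List.length_append, hφ, mul_comm]
  · rw [hmatrix, hg.isConvolutionMatrix.eq_zero hα, zero_mul]

theorem HasFourierRep.eq_homogeneousPart {k : ℕ} (hg : HasFourierRep f m g c)
    (hc : ∀ β, β.length ≠ k → c β = 0) : g = homogeneousPart c (weightedShift f m) k := by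
  refine ContinuousLinearMap.ext_on (dense_span_fockMonomial f m) ?_
  rintro _ ⟨α, rfl⟩
  have hzero (β : List (Fin n)) (hβ : β ∉ Set.range (List.ofFn (n := k))) :
      c β • fockMonomial f m (β ++ α) = 0 := by
    rw [hc β, zero_smul]
    rintro rfl
    exact hβ ⟨β.get, List.ofFn_get β⟩
  have hsum := (List.ofFn_injective.hasSum_iff hzero).2 (hg.hasSum_fockMonomial α)
  simpa [homogeneousPart, sum_apply, wordOp_weightedShift_fockMonomial] using
    hsum.unique (hasSum_fintype _)

theorem HasFourierRep.norm_homogeneousPart_le (hg : HasFourierRep f m g c) (k : ℕ) :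
    ‖homogeneousPart c (weightedShift f m) k‖ ≤ ‖g‖ := by
  have he := orthonormal_lp_single (ι := ℕ)
  obtain ⟨g', hle, hg'⟩ := hg.exists_radialMultiplier
    (s := fun i => (lp.single 2 (k + i) 1 : lp (fun _ : ℕ => ℂ) 2))
    (φ := fun j => if j = k then 1 else 0)
    (fun i => (he.norm_eq_one _).le) (fun i => (he.norm_eq_one i).le)
    (fun j i => by simp [orthonormal_iff_ite.1 he])
  have hk : g' = homogeneousPart c (weightedShift f m) k := by
    rw [hg'.eq_homogeneousPart (k := k) fun β hβ => by rw [if_neg hβ, zero_mul]]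
    simp [homogeneousPart]
  rwa [← hk]

theorem HasFourierRep.exists_dilation (hg : HasFourierRep f m g c) {r : ℝ} (hr : |r| ≤ 1) :
    ∃ g', ‖g'‖ ≤ ‖g‖ ∧ HasFourierRep f m g' fun β => (r : ℂ) ^ β.length * c β :=
  have he := orthonormal_lp_single (ι := ℕ)
  hg.exists_radialMultiplier (fun i => (norm_geomVec he hr i).le)
    (fun i => (norm_geomVec he hr i).le) (inner_geomVec_add he hr)

theorem HasFourierRep.tendsto_ncPartialSum_fockMonomial (hg : HasFourierRep f m g c)
    (α : List (Fin n)) :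
    Tendsto (fun N => ncPartialSum c (weightedShift f m) N (fockMonomial f m α)) atTop
      (𝓝 (g (fockMonomial f m α))) := by
  have hsum := (List.equivSigmaTuple.symm.hasSum_iff.2 (hg.hasSum_fockMonomial α)).sigma
    fun k => hasSum_fintype _
  refine hsum.tendsto_sum_nat.congr fun N => ?_
  simp [ncPartialSum, sum_apply, List.equivSigmaTuple, wordOp_weightedShift_fockMonomial]

theorem HasFourierRep.tendsto_ncPartialSum_smul (hg : HasFourierRep f m g c) {r : ℝ}
    (hr : |r| < 1) (hg' : HasFourierRep f m g' fun β => (r : ℂ) ^ β.length * c β) :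
    Tendsto (ncPartialSum c fun i => (r : ℂ) • weightedShift f m i) atTop (𝓝 g') := by
  have hsummable : Summable (homogeneousPart c fun i => (r : ℂ) • weightedShift f m i) := by
    refine .of_norm_bounded ((summable_geometric_of_abs_lt_one (r := |r|) (by simpa)).mul_right
      ‖g‖) fun k => ?_
    rw [homogeneousPart_smul, norm_smul, norm_pow, Complex.norm_real, Real.norm_eq_abs]
    gcongr
    exact hg.norm_homogeneousPart_le k
  have htendsto := hsummable.hasSum.tendsto_sum_nat
  simp only [← ncPartialSum_eq_sum_homogeneousPart] at htendsto
  convert htendsto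
  refine ContinuousLinearMap.ext_on (dense_span_fockMonomial f m) ?_
  rintro _ ⟨α, rfl⟩
  refine tendsto_nhds_unique ?_ (((apply ℂ _ (fockMonomial f m α)).continuous.tendsto _).comp
    htendsto)
  simpa only [Function.comp_def, apply_apply, ncPartialSum_smul] using
    hg'.tendsto_ncPartialSum_fockMonomial α

theorem exists_radialContraction (n : ℕ) {r : ℝ} (hr : |r| ≤ 1) :
    ∃ R : Fock n →L[ℂ] Fock n, ‖R‖ ≤ 1 ∧
      ∀ α, R (fockBasis α) = (r : ℂ) ^ α.length • fockBasis α := by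
  obtain ⟨R, hR, hRb⟩ := exists_schurMultiplier (L := ℂ) orthonormal_fockBasis
    orthonormal_fockBasis (s := fun α => (r : ℂ) ^ α.length) (t := fun _ => 1)
    (fun α => by simpa using pow_le_one₀ (abs_nonneg r) hr) (by simp) (1 : Fock n →L[ℂ] Fock n)
  refine ⟨R, hR.trans norm_id_le, fun α => ?_⟩
  ext ω
  have hω := hRb ω α
  simpa [inner_fockBasis_left, mul_comm] using hω

theorem tendsto_radialContraction {R : ℝ → Fock n →L[ℂ] Fock n}
    (hR : ∀ r ∈ Set.Ioo (0 : ℝ) 1, ‖R r‖ ≤ 1 ∧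
      ∀ α, R r (fockBasis α) = (r : ℂ) ^ α.length • fockBasis α) (x : Fock n) :
    Tendsto (fun r => R r x) (𝓝[<] 1) (𝓝 x) := by
  have hmem : Set.Ioo (0 : ℝ) 1 ∈ 𝓝[<] 1 := Ioo_mem_nhdsLT one_pos
  refine tendsto_apply_of_dense_span (B₀ := 1) (mem_of_superset hmem fun r hr => (hR r hr).1)
    dense_span_fockBasis ?_ x
  rintro _ ⟨α, rfl⟩
  have hcont : Continuous fun r : ℝ => (r : ℂ) ^ α.length • fockBasis α := by fun_prop
  have hlim : Tendsto (fun r : ℝ => (r : ℂ) ^ α.length • fockBasis α) (𝓝[<] 1)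
      (𝓝 (fockBasis α)) := by
    simpa using (hcont.tendsto 1).mono_left nhdsWithin_le_nhds
  refine hlim.congr' ?_
  filter_upwards [hmem] with r hr using ((hR r hr).2 α).symm

theorem HasFourierRep.radialContraction_apply (hg : HasFourierRep f m g c) {r : ℂ}
    (hg' : HasFourierRep f m g' fun β => r ^ β.length * c β) {R : Fock n →L[ℂ] Fock n}
    (hR : ∀ α, R (fockBasis α) = r ^ α.length • fockBasis α) (α : List (Fin n)) :
    R (g (fockMonomial f m α)) = r ^ α.length • g' (fockMonomial f m α) := by
  refine (R.hasSum (hg.hasSum_fockMonomial α)).unique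
    (((hg'.hasSum_fockMonomial α).const_smul _).congr_fun fun β => ?_)
  rw [fockMonomial, map_smul, map_smul, hR, List.length_append]
  module

theorem HasFourierRep.tendsto_dilation_apply (hg : HasFourierRep f m g c)
    {D : ℝ → Fock n →L[ℂ] Fock n} (hD : ∀ r ∈ Set.Ioo (0 : ℝ) 1, ‖D r‖ ≤ ‖g‖ ∧
      HasFourierRep f m (D r) fun β => (r : ℂ) ^ β.length * c β) (x : Fock n) :
    Tendsto (fun r => D r x) (𝓝[<] 1) (𝓝 (g x)) := by
  have hmem : Set.Ioo (0 : ℝ) 1 ∈ 𝓝[<] 1 := Ioo_mem_nhdsLT one_pos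
  choose! R hR using fun r (hr : r ∈ Set.Ioo (0 : ℝ) 1) =>
    exists_radialContraction n (abs_le.2 ⟨by linarith [hr.1], hr.2.le⟩)
  refine tendsto_apply_of_dense_span (mem_of_superset hmem fun r hr => (hD r hr).1)
    (dense_span_fockMonomial f m) ?_ x
  rintro _ ⟨α, rfl⟩
  have hinv : Tendsto (fun r : ℝ => ((r : ℂ) ^ α.length)⁻¹) (𝓝[<] 1) (𝓝 1) := by
    have hcont : ContinuousAt (fun r : ℝ => ((r : ℂ) ^ α.length)⁻¹) 1 :=
      ContinuousAt.inv₀ (by fun_prop) (by simp)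
    simpa using hcont.tendsto.mono_left nhdsWithin_le_nhds
  have hlim := hinv.smul (tendsto_radialContraction hR (g (fockMonomial f m α)))
  rw [one_smul] at hlim
  refine hlim.congr' ?_
  filter_upwards [hmem] with r hr
  rw [hg.radialContraction_apply (hD r hr).2 (hR r hr).2,
    inv_smul_smul₀ (pow_ne_zero _ (Complex.ofReal_ne_zero.2 hr.1.ne'))]

theorem HasFourierRep.exists_radialApproximation (hg : HasFourierRep f m g c) :
    ∃ D : ℝ → Fock n →L[ℂ] Fock n,
      (∀ r ∈ Set.Ioo (0 : ℝ) 1, ‖D r‖ ≤ ‖g‖ ∧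
        Tendsto (ncPartialSum c fun i => (r : ℂ) • weightedShift f m i) atTop (𝓝 (D r))) ∧
      ∀ x, Tendsto (fun r => D r x) (𝓝[<] 1) (𝓝 (g x)) := by
  have habs (r : ℝ) (hr : r ∈ Set.Ioo (0 : ℝ) 1) : |r| < 1 :=
    abs_lt.2 ⟨by linarith [hr.1], hr.2⟩
  choose! D hD using fun r (hr : r ∈ Set.Ioo (0 : ℝ) 1) => hg.exists_dilation (habs r hr).le
  exact ⟨D, fun r hr => ⟨(hD r hr).1, hg.tendsto_ncPartialSum_smul (habs r hr) (hD r hr).2⟩,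
    hg.tendsto_dilation_apply hD⟩

end Dilation

section Compression

variable {E G H : Type*} [NormedAddCommGroup E] [InnerProductSpace ℂ E] [NormedAddCommGroup G]
  [InnerProductSpace ℂ G] [NormedAddCommGroup H] [InnerProductSpace ℂ H]

theorem tendsto_ampliationL_apply {ι : Type*} {l : Filter ι} {C : ℝ} {g : ι → E →L[ℂ] E}
    {g₀ : E →L[ℂ] E} (hC : ∀ᶠ i in l, ‖g i‖ ≤ C)
    (h : ∀ x, Tendsto (fun i => g i x) l (𝓝 (g₀ x))) (ξ : HilbertTensor E G) :
    Tendsto (fun i => ampliationL G (g i) ξ) l (𝓝 (ampliationL G g₀ ξ)) := by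
  refine tendsto_apply_of_dense_span (hC.mono fun i hi => (norm_ampliationL_le (g i)).trans hi)
    (dense_span_hilbertTmul (s := Set.univ) (by simp)) ?_ ξ
  rintro _ ⟨x, -, k, -, rfl⟩
  simp only [ampliationL_hilbertTmul]
  exact ((hilbertTmul.flip k).continuous.tendsto _).comp (h x)

theorem tendsto_inner_ampliationL_apply {ι : Type*} {l : Filter ι} {C : ℝ} {g : ι → E →L[ℂ] E}
    {g₀ : E →L[ℂ] E} (hC : ∀ᶠ i in l, ‖g i‖ ≤ C)
    (h : ∀ x y, Tendsto (fun i => inner ℂ y (g i x)) l (𝓝 (inner ℂ y (g₀ x))))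
    (ξ η : HilbertTensor E G) :
    Tendsto (fun i => inner ℂ η (ampliationL G (g i) ξ)) l
      (𝓝 (inner ℂ η (ampliationL G g₀ ξ))) := by
  have hdense := dense_span_hilbertTmul (E := E) (H := G) (s := Set.univ) (by simp)
  refine tendsto_inner_apply_of_dense_span
    (hC.mono fun i hi => (norm_ampliationL_le (g i)).trans hi) hdense hdense ?_ ξ η
  rintro _ ⟨x, -, k, -, rfl⟩ _ ⟨y, -, k', -, rfl⟩
  simpa using (h x y).mul_const (inner ℂ k' k)

theorem tendsto_nhds_sot_iff {ι : Type*} {l : Filter ι} {F : ι → H →L[ℂ] H} {A : H →L[ℂ] H} :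
    Tendsto F l (@nhds _ (sot H) A) ↔ ∀ x, Tendsto (fun i => F i x) l (𝓝 (A x)) := by
  rw [nhds_induced, tendsto_comap_iff, PointwiseConvergenceCLM.tendsto_iff_forall_tendsto]
  rfl

variable [CompleteSpace H]

theorem tendsto_nhds_wot_iff {ι : Type*} {l : Filter ι} {F : ι → H →L[ℂ] H} {A : H →L[ℂ] H} :
    Tendsto F l (@nhds _ (wot H) A) ↔
      ∀ x y, Tendsto (fun i => inner ℂ y (F i x)) l (𝓝 (inner ℂ y (A x))) := by
  rw [nhds_induced, tendsto_comap_iff,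
    ContinuousLinearMapWOT.tendsto_iff_forall_inner_apply_tendsto]
  rfl

/-- The compression `g ↦ K* (g ⊗ I) K` of the ampliation along `K`. For `K` the Berezin kernel it is
the Berezin transform. -/
def ampliationCompression (K : H →L[ℂ] HilbertTensor E G) : (E →L[ℂ] E) →L[ℂ] H →L[ℂ] H :=
  compL ℂ H (HilbertTensor E G) H (adjoint K) ∘L
    (compL ℂ H (HilbertTensor E G) (HilbertTensor E G)).flip K ∘L ampliationL G

theorem ampliationCompression_apply (K : H →L[ℂ] HilbertTensor E G) (g : E →L[ℂ] E) :
    ampliationCompression K g = adjoint K ∘L ampliationL G g ∘L K :=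
  rfl

theorem tendsto_ampliationCompression_apply {ι : Type*} {l : Filter ι} {C : ℝ}
    (K : H →L[ℂ] HilbertTensor E G) {g : ι → E →L[ℂ] E} {g₀ : E →L[ℂ] E}
    (hC : ∀ᶠ i in l, ‖g i‖ ≤ C) (h : ∀ x, Tendsto (fun i => g i x) l (𝓝 (g₀ x))) (x : H) :
    Tendsto (fun i => ampliationCompression K (g i) x) l (𝓝 (ampliationCompression K g₀ x)) :=
  ((adjoint K).continuous.tendsto _).comp (tendsto_ampliationL_apply hC h (K x))

theorem continuousOn_sot_ampliationCompression (K : H →L[ℂ] HilbertTensor E G)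
    {S : Set (E →L[ℂ] E)} (hS : Bornology.IsBounded S) :
    @ContinuousOn _ _ (sot E) (sot H) (ampliationCompression K) S := by
  obtain ⟨C, hC⟩ := hS.exists_norm_le
  intro g₀ _
  have hbound := (@eventually_mem_nhdsWithin _ (sot E) g₀ S).mono hC
  have hlim := tendsto_nhds_sot_iff.1 (tendsto_id'.2 (@nhdsWithin_le_nhds _ (sot E) g₀ S))
  exact tendsto_nhds_sot_iff.2 (tendsto_ampliationCompression_apply K hbound hlim)

theorem continuousOn_wot_ampliationCompression [CompleteSpace E] (K : H →L[ℂ] HilbertTensor E G)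
    {S : Set (E →L[ℂ] E)} (hS : Bornology.IsBounded S) :
    @ContinuousOn _ _ (wot E) (wot H) (ampliationCompression K) S := by
  obtain ⟨C, hC⟩ := hS.exists_norm_le
  intro g₀ _
  have hbound := (@eventually_mem_nhdsWithin _ (wot E) g₀ S).mono hC
  have hlim := tendsto_nhds_wot_iff.1 (tendsto_id'.2 (@nhdsWithin_le_nhds _ (wot E) g₀ S))
  refine tendsto_nhds_wot_iff.2 fun x y => ?_
  simpa only [ampliationCompression_apply, ContinuousLinearMap.comp_apply, adjoint_inner_right]
    using tendsto_inner_ampliationL_apply hbound hlim (K x) (K y)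

end Compression

section CompleteContractivity

variable {E G H : Type*} [NormedAddCommGroup E] [InnerProductSpace ℂ E] [NormedAddCommGroup G]
  [InnerProductSpace ℂ G] [NormedAddCommGroup H] [InnerProductSpace ℂ H] {k : ℕ}

theorem matrixOp_apply (A : Matrix (Fin k) (Fin k) (E →L[ℂ] E)) (y : PiLp 2 fun _ : Fin k => E)
    (i : Fin k) : matrixOp A y i = ∑ j, A i j (y j) := by
  simp [matrixOp, sum_apply]

variable [CompleteSpace E]

theorem adjoint_proj_apply (j : Fin k) (x : E) :
    adjoint (PiLp.proj 2 (fun _ : Fin k => E) j : _ →L[ℂ] E) x = PiLp.single 2 j x :=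
  ext_inner_right ℂ fun y => by
    rw [adjoint_inner_left, PiLp.inner_apply, Finset.sum_eq_single j] <;> simp +contextual

theorem proj_comp_adjoint_proj (i j : Fin k) :
    (PiLp.proj 2 (fun _ : Fin k => E) i : _ →L[ℂ] E) ∘L
      adjoint (PiLp.proj 2 (fun _ : Fin k => E) j : _ →L[ℂ] E) = if i = j then 1 else 0 := by
  ext x
  rw [ContinuousLinearMap.comp_apply, adjoint_proj_apply]
  split_ifs with hij <;> simp [hij]

theorem proj_comp_matrixOp_comp_adjoint_proj (A : Matrix (Fin k) (Fin k) (E →L[ℂ] E))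
    (i j : Fin k) :
    (PiLp.proj 2 (fun _ : Fin k => E) i : _ →L[ℂ] E) ∘L matrixOp A ∘L
      adjoint (PiLp.proj 2 (fun _ : Fin k => E) j : _ →L[ℂ] E) = A i j := by
  ext x
  rw [ContinuousLinearMap.comp_apply, ContinuousLinearMap.comp_apply, adjoint_proj_apply,
    PiLp.proj_apply, matrixOp_apply, Finset.sum_eq_single j] <;> simp +contextual

/-- The operator `K ⊕ ⋯ ⊕ K` from `H^(k)` to `E^(k) ⊗ G`, the target being identified with
`(E ⊗ G)^(k)`. -/
def directSumKernel (k : ℕ) (K : H →L[ℂ] HilbertTensor E G) :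
    PiLp 2 (fun _ : Fin k => H) →L[ℂ] HilbertTensor (PiLp 2 fun _ : Fin k => E) G :=
  ∑ j, ampliationL G (adjoint (PiLp.proj 2 (fun _ : Fin k => E) j)) ∘L K ∘L
    PiLp.proj 2 (fun _ : Fin k => H) j

theorem inner_directSumKernel (K : H →L[ℂ] HilbertTensor E G)
    (A : PiLp 2 (fun _ : Fin k => E) →L[ℂ] PiLp 2 (fun _ : Fin k => E))
    (y z : PiLp 2 fun _ : Fin k => H) :
    inner ℂ (directSumKernel k K z) (ampliationL G A (directSumKernel k K y)) =
      ∑ i, ∑ j, inner ℂ (K (z i)) (ampliationL G (PiLp.proj 2 (fun _ : Fin k => E) i ∘L A ∘L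
        adjoint (PiLp.proj 2 (fun _ : Fin k => E) j)) (K (y j))) := by
  simp only [directSumKernel, sum_apply, map_sum, sum_inner, inner_sum,
    ContinuousLinearMap.comp_apply, ampliationL_comp, ← adjoint_ampliationL, adjoint_inner_left,
    PiLp.proj_apply]
  exact Finset.sum_comm

theorem norm_sq_directSumKernel_apply (K : H →L[ℂ] HilbertTensor E G)
    (y : PiLp 2 fun _ : Fin k => H) : ‖directSumKernel k K y‖ ^ 2 = ∑ j, ‖K (y j)‖ ^ 2 := by
  have h := inner_directSumKernel K 1 y y
  have hproj (i j : Fin k) (ξ : HilbertTensor E G) :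
      ampliationL G (PiLp.proj 2 (fun _ : Fin k => E) i ∘L 1 ∘L
        adjoint (PiLp.proj 2 (fun _ : Fin k => E) j)) ξ = if i = j then ξ else 0 := by
    rw [one_def, id_comp, proj_comp_adjoint_proj]
    split_ifs <;> simp [ampliationL_one]
  simp only [hproj, ampliationL_one, one_apply_eq_self, apply_ite (inner ℂ _), inner_zero_right,
    Finset.sum_ite_eq, Finset.mem_univ, if_true, inner_self_eq_norm_sq_to_K] at h
  exact_mod_cast h

theorem norm_directSumKernel_le (K : H →L[ℂ] HilbertTensor E G) :
    ‖directSumKernel k K‖ ≤ ‖K‖ := by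
  refine opNorm_le_bound _ (norm_nonneg K) fun y => ?_
  refine abs_le_of_sq_le_sq' ?_ (by positivity) |>.2
  calc ‖directSumKernel k K y‖ ^ 2 = ∑ j, ‖K (y j)‖ ^ 2 := norm_sq_directSumKernel_apply K y
    _ ≤ ∑ j, (‖K‖ * ‖y j‖) ^ 2 := by gcongr; exact K.le_opNorm _
    _ = (‖K‖ * ‖y‖) ^ 2 := by
      simp only [mul_pow, PiLp.norm_sq_eq_of_L2, Finset.mul_sum]

variable [CompleteSpace H]

theorem matrixOp_map_ampliationCompression (K : H →L[ℂ] HilbertTensor E G)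
    (x : Matrix (Fin k) (Fin k) (E →L[ℂ] E)) :
    matrixOp (x.map (ampliationCompression K)) =
      adjoint (directSumKernel k K) ∘L ampliationL G (matrixOp x) ∘L directSumKernel k K := by
  refine ContinuousLinearMap.ext fun y => ext_inner_left ℂ fun z => ?_
  rw [ContinuousLinearMap.comp_apply, adjoint_inner_right, ContinuousLinearMap.comp_apply,
    inner_directSumKernel, PiLp.inner_apply]
  simp only [proj_comp_matrixOp_comp_adjoint_proj, matrixOp_apply, inner_sum, Matrix.map_apply,
    ampliationCompression_apply, ContinuousLinearMap.comp_apply, adjoint_inner_right]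

theorem norm_matrixOp_map_ampliationCompression_le {K : H →L[ℂ] HilbertTensor E G} (hK : ‖K‖ ≤ 1)
    (x : Matrix (Fin k) (Fin k) (E →L[ℂ] E)) :
    ‖matrixOp (x.map (ampliationCompression K))‖ ≤ ‖matrixOp x‖ := by
  have hV : ‖directSumKernel k K‖ ≤ 1 := (norm_directSumKernel_le K).trans hK
  rw [matrixOp_map_ampliationCompression]
  calc _ ≤ ‖adjoint (directSumKernel k K)‖ * (‖ampliationL G (matrixOp x)‖ *
        ‖directSumKernel k K‖) := by grw [opNorm_comp_le, opNorm_comp_le]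
    _ ≤ 1 * (‖matrixOp x‖ * 1) := by
      rw [LinearIsometryEquiv.norm_map]
      gcongr
      exact norm_ampliationL_le _
    _ = ‖matrixOp x‖ := by rw [one_mul, mul_one]

end CompleteContractivity

section Intertwined

variable {E G H : Type*} [NormedAddCommGroup E] [InnerProductSpace ℂ E] [NormedAddCommGroup G]
  [InnerProductSpace ℂ G] [NormedAddCommGroup H] [InnerProductSpace ℂ H] [CompleteSpace H]
  {K : H →L[ℂ] HilbertTensor E G} {g h : E →L[ℂ] E}

/-- The operators `g` with `K* (g ⊗ I) = Φ(g) K*`, where `Φ` is the compression along `K`. On them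
`Φ` is multiplicative. -/
def intertwinedOperators (K : H →L[ℂ] HilbertTensor E G) : Set (E →L[ℂ] E) :=
  {g | adjoint K ∘L ampliationL G g = ampliationCompression K g ∘L adjoint K}

theorem ampliationCompression_eq_of_intertwine (hK : adjoint K ∘L K = 1) {A : H →L[ℂ] H}
    (hA : adjoint K ∘L ampliationL G g = A ∘L adjoint K) : ampliationCompression K g = A := by
  rw [ampliationCompression_apply, ← ContinuousLinearMap.comp_assoc, hA,
    ContinuousLinearMap.comp_assoc, hK, one_def, comp_id]

theorem ampliationCompression_one (hK : adjoint K ∘L K = 1) : ampliationCompression K 1 = 1 := by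
  rw [ampliationCompression_apply, ampliationL_one, one_def, id_comp, hK, one_def]

theorem ampliationCompression_comp (hg : g ∈ intertwinedOperators K) :
    ampliationCompression K (g ∘L h) = ampliationCompression K g ∘L ampliationCompression K h := by
  rw [ampliationCompression_apply, ampliationL_comp, ContinuousLinearMap.comp_assoc,
    ← ContinuousLinearMap.comp_assoc, hg, ContinuousLinearMap.comp_assoc,
    ← ampliationCompression_apply]

theorem isClosed_intertwinedOperators (K : H →L[ℂ] HilbertTensor E G) :
    IsClosed (intertwinedOperators K) :=
  isClosed_eq (by fun_prop) (by fun_prop)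

theorem mem_intertwinedOperators_of_tendsto_apply {ι : Type*} {l : Filter ι} [l.NeBot] {C : ℝ}
    {F : ι → E →L[ℂ] E} (hF : ∀ᶠ i in l, F i ∈ intertwinedOperators K)
    (hC : ∀ᶠ i in l, ‖F i‖ ≤ C) (hlim : ∀ x, Tendsto (fun i => F i x) l (𝓝 (g x))) :
    g ∈ intertwinedOperators K := by
  refine ContinuousLinearMap.ext fun ξ => tendsto_nhds_unique
    (((adjoint K).continuous.tendsto _).comp (tendsto_ampliationL_apply hC hlim ξ)) ?_
  refine (tendsto_ampliationCompression_apply K hC hlim (adjoint K ξ)).congr' ?_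
  filter_upwards [hF] with i hi using congr($hi.symm ξ)

end Intertwined

section Transform

variable {n m : ℕ} {H : Type*} [NormedAddCommGroup H] [InnerProductSpace ℂ H] [CompleteSpace H]
  {f : PosRegularSeries n} {T : Fin n → H →L[ℂ] H} {g : Fock n →L[ℂ] Fock n}
  {c : List (Fin n) → ℂ}

theorem adjoint_kernel_comp_ampliationL_ncPartialSum {K : H →L[ℂ] FockTensor n H}
    (hK : IsColumn fockBasis (kernelEntry f m T) K) (c : List (Fin n) → ℂ) (r : ℂ) (N : ℕ) :
    adjoint K ∘L ampliationL H (ncPartialSum c (fun i => r • weightedShift f m i) N) =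
      ncPartialSum c (fun i => r • T i) N ∘L adjoint K := by
  rw [ncPartialSum_smul, ncPartialSum_smul]
  simp only [ncPartialSum, map_sum, map_smul, ContinuousLinearMap.comp_finsetSum,
    ContinuousLinearMap.finsetSum_comp, ContinuousLinearMap.comp_smul,
    ContinuousLinearMap.smul_comp, adjoint_kernel_comp_ampliationL_wordOp hK]

variable (hm : 1 ≤ m) (hT : T ∈ ncDomain f m H) (hpure : IsPure f T)
include hm hT hpure

theorem adjoint_berezinKernel_comp_self :
    adjoint (berezinKernel f m T) ∘L berezinKernel f m T = 1 :=
  (norm_map_iff_adjoint_comp_self _).1 (norm_berezinKernel_apply hm hT hpure)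

theorem berezinTransform_wordOp (α : List (Fin n)) :
    berezinTransform f m T (wordOp (weightedShift f m) α) = wordOp T α :=
  ampliationCompression_eq_of_intertwine (adjoint_berezinKernel_comp_self hm hT hpure)
    (adjoint_kernel_comp_ampliationL_wordOp (isColumn_berezinKernel hm hT hpure) α)

theorem ampliationCompression_berezinKernel_ncPartialSum (c : List (Fin n) → ℂ) (r : ℂ) (N : ℕ) :
    ampliationCompression (berezinKernel f m T)
      (ncPartialSum c (fun i => r • weightedShift f m i) N) =
        ncPartialSum c (fun i => r • T i) N :=
  ampliationCompression_eq_of_intertwine (adjoint_berezinKernel_comp_self hm hT hpure)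
    (adjoint_kernel_comp_ampliationL_ncPartialSum (isColumn_berezinKernel hm hT hpure) c r N)

theorem ncPartialSum_mem_intertwinedOperators (c : List (Fin n) → ℂ) (r : ℂ) (N : ℕ) :
    ncPartialSum c (fun i => r • weightedShift f m i) N ∈
      intertwinedOperators (berezinKernel f m T) := by
  rw [intertwinedOperators, Set.mem_ofPred_eq,
    ampliationCompression_berezinKernel_ncPartialSum hm hT hpure]
  exact adjoint_kernel_comp_ampliationL_ncPartialSum (isColumn_berezinKernel hm hT hpure) c r N

theorem HasFourierRep.mem_intertwinedOperators (hg : HasFourierRep f m g c) :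
    g ∈ intertwinedOperators (berezinKernel f m T) := by
  obtain ⟨D, hD, hlim⟩ := hg.exists_radialApproximation
  have hmem : Set.Ioo (0 : ℝ) 1 ∈ 𝓝[<] 1 := Ioo_mem_nhdsLT one_pos
  refine mem_intertwinedOperators_of_tendsto_apply (mem_of_superset hmem fun r hr => ?_)
    (mem_of_superset hmem fun r hr => (hD r hr).1) hlim
  exact (isClosed_intertwinedOperators _).mem_of_tendsto (hD r hr).2
    (.of_forall fun N => ncPartialSum_mem_intertwinedOperators hm hT hpure c r N)

theorem HasFourierRep.exists_radialLimit (hg : HasFourierRep f m g c) :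
    ∃ G : ℝ → H →L[ℂ] H,
      (∀ r ∈ Set.Ioo (0 : ℝ) 1, Tendsto (ncPartialSum c fun i => (r : ℂ) • T i) atTop (𝓝 (G r))) ∧
      ∀ x, Tendsto (fun r => G r x) (𝓝[<] 1) (𝓝 (berezinTransform f m T g x)) := by
  obtain ⟨D, hD, hlim⟩ := hg.exists_radialApproximation
  refine ⟨fun r => ampliationCompression (berezinKernel f m T) (D r), fun r hr => ?_,
    tendsto_ampliationCompression_apply _
      (mem_of_superset (Ioo_mem_nhdsLT one_pos) fun r hr => (hD r hr).1) hlim⟩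
  exact (((ampliationCompression (berezinKernel f m T)).continuous.tendsto _).comp
    (hD r hr).2).congr (ampliationCompression_berezinKernel_ncPartialSum hm hT hpure c r)

/-- The Berezin transform restricted to the Hardy algebra, the map `Ψ_T` of the paper. -/
def berezinAlgHom : hardyAlgebra f m →ₐ[ℂ] (H →L[ℂ] H) :=
  AlgHom.ofLinearMap ((ampliationCompression (berezinKernel f m T)).toLinearMap ∘ₗ
      (hardyAlgebra f m).val.toLinearMap)
    (ampliationCompression_one (adjoint_berezinKernel_comp_self hm hT hpure))
    fun ⟨_, _, hg⟩ _ => ampliationCompression_comp (hg.mem_intertwinedOperators hm hT hpure)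

theorem isCompletelyContractive_berezinAlgHom :
    IsCompletelyContractive (berezinAlgHom hm hT hpure).toLinearMap := fun _ x =>
  have hK : ‖berezinKernel f m T‖ ≤ 1 :=
    opNorm_le_bound _ zero_le_one fun h => by
      rw [norm_berezinKernel_apply hm hT hpure, one_mul]
  norm_matrixOp_map_ampliationCompression_le hK (x.map Subtype.val)

end Transform

end

theorem theorem3p4_general {n m : ℕ} (hm : 1 ≤ m)
    {H : Type*} [NormedAddCommGroup H] [InnerProductSpace ℂ H] [CompleteSpace H]
    (f : PosRegularSeries n) (T : Fin n → H →L[ℂ] H) (hT : T ∈ ncDomain f m H)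
    (hpure : IsPure f T) :
    (∀ h, HasSum (kernelTerm f m T h) (berezinKernel f m T h)) ∧
    ∃ A : Subalgebra ℂ (Fock n →L[ℂ] Fock n), (A : Set (Fock n →L[ℂ] Fock n)) = hardySet f m ∧
    ∃ Ψ : A →ₐ[ℂ] (H →L[ℂ] H), (∀ g : A, Ψ g = berezinTransform f m T g) ∧
      (∀ S : Set (Fock n →L[ℂ] Fock n), Bornology.IsBounded S →
        @ContinuousOn _ _ (wot (Fock n)) (wot H) (berezinTransform f m T) S ∧
        @ContinuousOn _ _ (sot (Fock n)) (sot H) (berezinTransform f m T) S) ∧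
      IsCompletelyContractive Ψ.toLinearMap ∧
      (∀ α : List (Fin n), ∃ hα : wordOp (weightedShift f m) α ∈ A,
        Ψ ⟨wordOp (weightedShift f m) α, hα⟩ = wordOp T α) ∧
      ∀ (g : A) (c : List (Fin n) → ℂ), HasFourierRep f m (g : Fock n →L[ℂ] Fock n) c →
        ∃ G : ℝ → H →L[ℂ] H,
          (∀ r ∈ Set.Ioo (0 : ℝ) 1,
            Tendsto (ncPartialSum c (fun i => (r : ℂ) • T i)) atTop (𝓝 (G r))) ∧
          ∀ x : H, Tendsto (fun r => G r x) (𝓝[<] 1) (𝓝 (Ψ g x)) :=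
  ⟨fun h => hasSum_kernelTerm hm hT hpure h, hardyAlgebra f m, rfl, berezinAlgHom hm hT hpure,
    fun _ => rfl,
    fun _ hS => ⟨continuousOn_wot_ampliationCompression (berezinKernel f m T) hS,
      continuousOn_sot_ampliationCompression (berezinKernel f m T) hS⟩,
    isCompletelyContractive_berezinAlgHom hm hT hpure,
    fun α => ⟨⟨_, hasFourierRep_wordOp f m α⟩, berezinTransform_wordOp hm hT hpure α⟩,
    fun _ _ hg => hg.exists_radialLimit hm hT hpure⟩

theorem theorem3p4 {n m : ℕ} (hn : 1 ≤ n) (hm : 1 ≤ m)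
    {H : Type*} [NormedAddCommGroup H] [InnerProductSpace ℂ H] [CompleteSpace H]
    (f : PosRegularSeries n) (ρ : ℝ) (hρ : 0 < ρ) (hf : f.FreeHolomorphicOn H ρ)
    (T : Fin n → H →L[ℂ] H) (hT : T ∈ ncDomain f m H) (hpure : IsPure f T) :
    -- the Berezin kernel at `T` is well defined
    (∀ h, HasSum (kernelTerm f m T h) (berezinKernel f m T h)) ∧
    -- the Hardy algebra is a unital algebra `A`, and the restriction `Ψ` of the Berezin transform
    -- to it is a unital algebra homomorphism
    ∃ A : Subalgebra ℂ (Fock n →L[ℂ] Fock n), (A : Set (Fock n →L[ℂ] Fock n)) = hardySet f m ∧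
    ∃ Ψ : A →ₐ[ℂ] (H →L[ℂ] H), (∀ g : A, Ψ g = berezinTransform f m T g) ∧
      -- (i) continuity on bounded sets
      (∀ S ⊆ hardySet f m, Bornology.IsBounded S →
        @ContinuousOn _ _ (wot (Fock n)) (wot H) (berezinTransform f m T) S ∧
        @ContinuousOn _ _ (sot (Fock n)) (sot H) (berezinTransform f m T) S) ∧
      -- (ii)
      IsCompletelyContractive Ψ.toLinearMap ∧
      (∀ α : List (Fin n), ∃ hα : wordOp (weightedShift f m) α ∈ A,
        Ψ ⟨wordOp (weightedShift f m) α, hα⟩ = wordOp T α) ∧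
      -- radial limits
      (HasRadialProperty f m (weightedShift f m) →
        ∀ (g : A) (c : List (Fin n) → ℂ), HasFourierRep f m (g : Fock n →L[ℂ] Fock n) c →
          ∃ G : ℝ → H →L[ℂ] H,
            (∀ r ∈ Set.Ioo (0 : ℝ) 1,
              Tendsto (ncPartialSum c (fun i => (r : ℂ) • T i)) atTop (𝓝 (G r))) ∧
            ∀ x : H, Tendsto (fun r => G r x) (𝓝[<] 1) (𝓝 (Ψ g x))) := by
  obtain ⟨hK, A, hA, Ψ, hΨ, hcont, hcc, hW, hrad⟩ := theorem3p4_general hm f T hT hpure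
  exact ⟨hK, A, hA, Ψ, hΨ, fun S _ => hcont S, hcc, hW, fun _ => hrad⟩
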